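/- Proposition. Let $\Omega\subset\mathbb R^3$ be a non-empty, convex, open and bounded set with piecewise $C^2$ boundary; that is, $\partial\Omega=\bigcup_{i=1}^m\overline{\Gamma_i}$ with finitely many pairwise disjoint, connected, relatively open subsets $\Gamma_i\subset\partial\Omega$ such that each closed face $\overline{\Gamma_i}$ is, near each of its points, contained in a regular $C^2$ surface. Then there are constants $c,\kappa>0$, a sequence of positive numbers $h\to0$ and, for each $h$ of the sequence, a polyhedral domain $\Omega_h\subset\Omega$ with a triangulation $\mathcal T_h$ (a finite conforming tetrahedralization, $\Omega_h$ being connected and equal to the interior of the union of its tetrahedra) such that 1. $\Omega_h$ is discrete convex: for every vertex $z$ of $\mathcal T_h$ on $\partial\Omega_h$ there is a support plane of $\Omega_h$ at $z$, i.e. a vector $v\neq0$ with $(z-x)\cdot v\ge0$ for all $x\in\Omega_h$; 2. $\mathcal T_h$ has maximal mesh size $h$, i.e. $\max_{T\in\mathcal T_h}\operatorname{diam}T=h$; 3. the triangulations are uniformly shape regular: every $T\in\mathcal T_h$ contains a ball of some radius $r>0$ with $\operatorname{diam}T\le\kappa r$; 4. $\Omega_h\,\Delta\,\Omega\subset\{x\in\mathbb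 R^3:\operatorname{dist}(x,\partial\Omega)\le c h^2\}$. In particular $\chi_{\Omega_h}\to\chi_\Omega$ in $L^1(\mathbb R^3)$ as $h\to0$. -/

import Mathlib

open Set Filter Topology MeasureTheory

/-- Euclidean three-space. -/
abbrev R3 : Type := EuclideanSpace ℝ (Fin 3)

/-- `S` is (a subset of) an embedded `C²` surface near each of its points: locally it is contained
in the zero set of a `C²` function with non-vanishing derivative. -/
def LiesInC2Surface (S : Set R3) : Prop :=
  ∀ p ∈ S, ∃ U : Set R3, IsOpen U ∧ p ∈ U ∧ ∃ g : R3 → ℝ,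
    ContDiffOn ℝ 2 g U ∧ (∀ x ∈ U, fderiv ℝ g x ≠ 0) ∧ ∀ x ∈ S ∩ U, g x = 0

/-- The boundary of `Ω` is piecewise `C²`: it is the union of the closures of finitely many
pairwise disjoint, connected, relatively open faces, and each face is of class `C²` up to its
boundary, that is, its closure lies in a `C²` surface near each of its points. -/
def HasPiecewiseC2Boundary (Ω : Set R3) : Prop :=
  ∃ (m : ℕ) (Γ : Fin m → Set R3),
    (∀ i, IsConnected (Γ i)) ∧
    (∀ i, ∃ O : Set R3, IsOpen O ∧ Γ i = O ∩ frontier Ω) ∧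
    Pairwise (fun i j => Disjoint (Γ i) (Γ j)) ∧
    frontier Ω = ⋃ i, closure (Γ i) ∧
    ∀ i, LiesInC2Surface (closure (Γ i))

/-- The tetrahedra of a simplicial complex in three-space, given by their four vertices. -/
def tetrahedra (K : Geometry.SimplicialComplex ℝ R3) : Set (Finset R3) :=
  {s | s ∈ K.faces ∧ s.card = 4}

/-- `K` is a (conforming, affine, tetrahedral) triangulation of the polyhedral bounded domain `Ω`:
`K` is a finite simplicial complex, every simplex of `K` is a face of a tetrahedron of `K`, and `Ω`
is a connected open set, namely the interior of the union of the tetrahedra. -/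
structure IsTriangulation (K : Geometry.SimplicialComplex ℝ R3) (Ω : Set R3) : Prop where
  finite : K.faces.Finite
  pure : ∀ s ∈ K.faces, ∃ t ∈ tetrahedra K, s ⊆ t
  eq_interior : Ω = interior K.space
  connected : IsConnected Ω

/-- The maximal mesh size of `K` is `h`: the largest diameter of a tetrahedron of `K` is `h`. -/
def HasMaximalMeshSize (K : Geometry.SimplicialComplex ℝ R3) (h : ℝ) : Prop :=
  IsGreatest ((fun s : Finset R3 => Metric.diam (convexHull ℝ (s : Set R3))) '' tetrahedra K) h

/-- `K` is shape regular with constant `κ`: every tetrahedron `T` of `K` contains a ball of some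
radius `r > 0` with `diam T ≤ κ r`. -/
def IsShapeRegular (K : Geometry.SimplicialComplex ℝ R3) (κ : ℝ) : Prop :=
  ∀ s ∈ tetrahedra K, ∃ (x : R3) (r : ℝ), 0 < r ∧
    Metric.closedBall x r ⊆ convexHull ℝ (s : Set R3) ∧
    Metric.diam (convexHull ℝ (s : Set R3)) ≤ κ * r

/-- There is a support plane for `Ω` at `z`, with normal vector `v`:
`Ω` lies in the half-space `{x | 0 ≤ (z - x) · v}`. -/
def HasSupportPlaneAt (Ω : Set R3) (z : R3) : Prop :=
  ∃ v : R3, v ≠ 0 ∧ ∀ x ∈ Ω, 0 ≤ inner ℝ (z - x) v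

/-- The polyhedral bounded domain `Ω` with triangulation `K` is discrete convex: `Ω` has a support
plane at every vertex of `K` on the boundary of `Ω`. -/
def IsDiscreteConvex (K : Geometry.SimplicialComplex ℝ R3) (Ω : Set R3) : Prop :=
  IsTriangulation K Ω ∧ ∀ z ∈ K.vertices ∩ frontier Ω, HasSupportPlaneAt Ω z

/-! Translate so that the origin lies in the domain and let `g` be its gauge: a convex function,
Lipschitz and comparable to the norm, with `g < 1` inside and `g = 1` on the boundary. The mesh
grows outward from the origin, and it is graded: the tetrahedra have size of order `h` near the
origin and of order `h ^ 2` at the boundary. All vertices of the final front lie on `g = 1`.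
Subadditivity of `g` keeps the body inside the domain, so a support plane of the domain at a
boundary vertex also supports the body. The final triangles have diameter of order `h ^ 2`, so the
Lipschitz bound for `g` alone leaves a gap of that order.

The combinatorics rest on `IsFront.star`. The body is star-shaped, and the cones over its boundary
triangles form a complete simplicial fan. Starring a face of the front at a point `p` beyond it adds
the tetrahedra spanned by `p` and the triangles containing the face, and refines the fan. In terms
of weights, `p = bary μ` with `mass μ > 1`, and replacing `p` by `μ` carries every question back to
the old fan. Uniqueness of convex weights then yields the simplicial complex.

The geometry rests on two moves, `IsMesh.raise` and `IsMesh.bisect`. Directions form a triangulation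
of the octahedron refined by bisection: after `ℓ` bisections the angular size is `rho ^ (2 * ℓ)`.
The height at that stage is `rho ^ (L - ℓ)`, so the front triangles have size of order `rho ^ (L +
ℓ)`: this is `rho ^ L` at the start and its square at the end. Each radial step is comparable to the
current triangle size, and `isGoodSimplex_insert` turns this into uniform shape regularity.
`IsMesh.level` performs one bisection and `exists_graded_mesh` iterates it. -/

/-! ### Fronts: star-shaped triangulated bodies and the starring operation. -/

section Front

open scoped Classical

/-- The point with weights `w`. -/
noncomputable def bary : (R3 →₀ ℝ) →ₗ[ℝ] R3 := Finsupp.linearCombination ℝ id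

/-- The total mass of the weights `w`. -/
noncomputable def mass : (R3 →₀ ℝ) →ₗ[ℝ] ℝ := Finsupp.linearCombination ℝ fun _ => (1 : ℝ)

@[simp] lemma bary_single (p : R3) (c : ℝ) : bary (Finsupp.single p c) = c • p := by simp [bary]

@[simp] lemma mass_single (p : R3) (c : ℝ) : mass (Finsupp.single p c) = c := by simp [mass]

/-- `w` is a family of nonnegative weights on the vertices in `σ`. -/
def WeightsOn (σ : Finset R3) (w : R3 →₀ ℝ) : Prop :=
  (∀ v, 0 ≤ w v) ∧ ∀ v ∉ σ, w v = 0

lemma WeightsOn.mono {σ σ' : Finset R3} {w : R3 →₀ ℝ} (h : WeightsOn σ w) (hσ : σ ⊆ σ') :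
    WeightsOn σ' w :=
  ⟨h.1, fun v hv => h.2 v fun hv' => hv (hσ hv')⟩

lemma bary_eq_sum {σ : Finset R3} {w : R3 →₀ ℝ} (h : ∀ v ∉ σ, w v = 0) :
    bary w = ∑ v ∈ σ, w v • v := by
  rw [bary, Finsupp.linearCombination_apply, Finsupp.sum]
  refine Finset.sum_subset (fun v hv => ?_) fun v _ hv => ?_
  · by_contra hv'
    exact (Finsupp.mem_support_iff.1 hv) (h v hv')
  · simp [Finsupp.notMem_support_iff.1 hv]

lemma mass_eq_sum {σ : Finset R3} {w : R3 →₀ ℝ} (h : ∀ v ∉ σ, w v = 0) :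
    mass w = ∑ v ∈ σ, w v := by
  rw [mass, Finsupp.linearCombination_apply, Finsupp.sum]
  refine (Finset.sum_subset (fun v hv => ?_) fun v _ hv => ?_).trans
    (Finset.sum_congr rfl fun v _ => mul_one _)
  · by_contra hv'
    exact (Finsupp.mem_support_iff.1 hv) (h v hv')
  · simp [Finsupp.notMem_support_iff.1 hv]

lemma WeightsOn.mass_nonneg {σ : Finset R3} {w : R3 →₀ ℝ} (h : WeightsOn σ w) : 0 ≤ mass w := by
  rw [mass_eq_sum h.2]
  exact Finset.sum_nonneg fun v _ => h.1 v

lemma mem_convexHull_iff_weightsOn {s : Finset R3} {x : R3} :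
    x ∈ convexHull ℝ (s : Set R3) ↔ ∃ u, WeightsOn s u ∧ mass u = 1 ∧ bary u = x := by
  rw [Finset.mem_convexHull']
  constructor
  · rintro ⟨w, h0, h1, hx⟩
    have hz : ∀ v ∉ s, (Finsupp.indicator s fun i _ => w i) v = 0 := fun v hv => by
      simp [Finsupp.indicator_apply, hv]
    refine ⟨Finsupp.indicator s fun i _ => w i, ⟨fun v => ?_, hz⟩, ?_, ?_⟩
    · rw [Finsupp.indicator_apply]
      split_ifs with hv
      exacts [h0 v hv, le_rfl]
    · rw [mass_eq_sum hz, ← h1]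
      exact Finset.sum_congr rfl fun v hv => by simp [Finsupp.indicator_apply, hv]
    · rw [bary_eq_sum hz, ← hx]
      exact Finset.sum_congr rfl fun v hv => by simp [Finsupp.indicator_apply, hv]
  · rintro ⟨u, hu, h1, hx⟩
    exact ⟨u, fun v _ => hu.1 v, by rw [← mass_eq_sum hu.2, h1], by rw [← bary_eq_sum hu.2, hx]⟩

/-- `x` lies strictly below the front `𝒯`. -/
def BelowFront (𝒯 : Finset (Finset R3)) (x : R3) : Prop :=
  ∃ σ ∈ 𝒯, ∃ w, WeightsOn σ w ∧ bary w = x ∧ mass w < 1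

/-- The union of the convex hulls of the members of `𝒦`. -/
def hullUnion (𝒦 : Finset (Finset R3)) : Set R3 := ⋃ s ∈ 𝒦, convexHull ℝ (s : Set R3)

lemma mem_hullUnion {𝒦 : Finset (Finset R3)} {x : R3} :
    x ∈ hullUnion 𝒦 ↔ ∃ s ∈ 𝒦, ∃ u, WeightsOn s u ∧ mass u = 1 ∧ bary u = x := by
  simp [hullUnion, mem_convexHull_iff_weightsOn]

/-- The family `𝒦` of tetrahedra triangulates a body, star-shaped with respect to the origin, whose
boundary is the union of the triangles in `𝒯`: the cones over these triangles form a complete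
simplicial fan. -/
structure IsFront (𝒯 𝒦 : Finset (Finset R3)) : Prop where
  cone_unique : ∀ σ ∈ 𝒯, ∀ σ' ∈ 𝒯, ∀ w w', WeightsOn σ w → WeightsOn σ' w' →
    bary w = bary w' → w = w'
  cone_cover : ∀ x, ∃ σ ∈ 𝒯, ∃ w, WeightsOn σ w ∧ bary w = x
  unique : ∀ s ∈ 𝒦, ∀ s' ∈ 𝒦, ∀ u u', WeightsOn s u → WeightsOn s' u' → mass u = 1 → mass u' = 1 →
    bary u = bary u' → u = u'
  body : ∀ σ ∈ 𝒯, ∀ w, WeightsOn σ w → (bary w ∈ hullUnion 𝒦 ↔ mass w ≤ 1)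
  sub : ∀ σ ∈ 𝒯, ∃ s ∈ 𝒦, σ ⊆ s
  vert : ∀ s ∈ 𝒦, ∀ z ∈ s, (∃ σ ∈ 𝒯, z ∈ σ) ∨ BelowFront 𝒯 z
  card_front : ∀ σ ∈ 𝒯, σ.card = 3
  card_tet : ∀ s ∈ 𝒦, s.card = 4

/-- Replace the vertex `p` by the weights `μ`. -/
noncomputable def substWeights (p : R3) (μ w : R3 →₀ ℝ) : R3 →₀ ℝ :=
  w - Finsupp.single p (w p) + w p • μ

lemma bary_substWeights {p : R3} {μ : R3 →₀ ℝ} (hp : bary μ = p) (w : R3 →₀ ℝ) :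
    bary (substWeights p μ w) = bary w := by
  simp [substWeights, hp]

lemma mass_substWeights (p : R3) (μ w : R3 →₀ ℝ) :
    mass (substWeights p μ w) = mass w + w p * (mass μ - 1) := by
  simp [substWeights]; ring

lemma substWeights_of_ne {p v : R3} (μ w : R3 →₀ ℝ) (hv : v ≠ p) :
    substWeights p μ w v = w v + w p * μ v := by
  simp [substWeights, hv.symm]

lemma substWeights_self {p : R3} {μ : R3 →₀ ℝ} (hμ : μ p = 0) (w : R3 →₀ ℝ) :
    substWeights p μ w p = 0 := by
  simp [substWeights, hμ]

lemma substWeights_of_zero {p : R3} (μ : R3 →₀ ℝ) {w : R3 →₀ ℝ} (hw : w p = 0) :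
    substWeights p μ w = w := by
  simp [substWeights, hw]

lemma eq_of_substWeights_eq {p : R3} {μ w w' : R3 →₀ ℝ}
    (h : substWeights p μ w = substWeights p μ w') (hp : w p = w' p) : w = w' := by
  simpa [substWeights, hp] using h

/-- The front after the faces `τ = μ.support` are starred with the new vertex `p`. -/
noncomputable def starFront (𝒯 : Finset (Finset R3)) (τ : Finset R3) (p : R3) :
    Finset (Finset R3) :=
  (𝒯.filter fun σ => ¬ τ ⊆ σ) ∪
    (𝒯.filter fun σ => τ ⊆ σ).biUnion fun σ => τ.image fun i => insert p (σ.erase i)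

lemma mem_starFront {𝒯 : Finset (Finset R3)} {τ : Finset R3} {p : R3} {σ : Finset R3} :
    σ ∈ starFront 𝒯 τ p ↔
      (σ ∈ 𝒯 ∧ ¬ τ ⊆ σ) ∨ ∃ σ₀ ∈ 𝒯, τ ⊆ σ₀ ∧ ∃ i ∈ τ, σ = insert p (σ₀.erase i) := by
  simp only [starFront, Finset.mem_union, Finset.mem_filter, Finset.mem_biUnion, Finset.mem_image]
  constructor
  · rintro (h | ⟨σ₀, ⟨h1, h2⟩, i, hi, rfl⟩)
    exacts [Or.inl h, Or.inr ⟨σ₀, h1, h2, i, hi, rfl⟩]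
  · rintro (h | ⟨σ₀, h1, h2, i, hi, rfl⟩)
    exacts [Or.inl h, Or.inr ⟨σ₀, ⟨h1, h2⟩, i, hi, rfl⟩]

/-- The tetrahedra after the faces `τ = μ.support` are starred with the new vertex `p`. -/
noncomputable def starTets (𝒯 𝒦 : Finset (Finset R3)) (τ : Finset R3) (p : R3) :
    Finset (Finset R3) :=
  𝒦 ∪ (𝒯.filter fun σ => τ ⊆ σ).image fun σ => insert p σ

lemma mem_starTets {𝒯 𝒦 : Finset (Finset R3)} {τ : Finset R3} {p : R3} {s : Finset R3} :
    s ∈ starTets 𝒯 𝒦 τ p ↔ s ∈ 𝒦 ∨ ∃ σ ∈ 𝒯, τ ⊆ σ ∧ s = insert p σ := by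
  simp only [starTets, Finset.mem_union, Finset.mem_filter, Finset.mem_image]
  constructor
  · rintro (h | ⟨σ₀, ⟨h1, h2⟩, rfl⟩)
    exacts [Or.inl h, Or.inr ⟨σ₀, h1, h2, rfl⟩]
  · rintro (h | ⟨σ₀, h1, h2, rfl⟩)
    exacts [Or.inl h, Or.inr ⟨σ₀, ⟨h1, h2⟩, rfl⟩]

lemma WeightsOn.substWeights {p : R3} {μ w : R3 →₀ ℝ} {σ : Finset R3} (hμ : ∀ v, 0 ≤ μ v)
    (hσ : μ.support ⊆ σ) (hp : p ∉ σ) (hw : WeightsOn (insert p σ) w) :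
    WeightsOn σ (substWeights p μ w) := by
  have hμp : μ p = 0 := Finsupp.notMem_support_iff.1 fun h => hp (hσ h)
  refine ⟨fun v => ?_, fun v hv => ?_⟩
  · by_cases hvp : v = p
    · rw [hvp, substWeights_self hμp]
    · rw [substWeights_of_ne _ _ hvp]
      exact add_nonneg (hw.1 v) (mul_nonneg (hw.1 p) (hμ v))
  · by_cases hvp : v = p
    · rw [hvp, substWeights_self hμp]
    · rw [substWeights_of_ne _ _ hvp, hw.2 v (by simp [hvp, hv]),
        Finsupp.notMem_support_iff.1 fun h => hv (hσ h)]
      simp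

namespace IsFront

variable {𝒯 𝒦 : Finset (Finset R3)} {μ : R3 →₀ ℝ} {p : R3}

/-- If `p` were a vertex of the front, the unit weight at `p` and `μ` would represent the same point
in the fan, hence coincide, although their masses are `1` and more than `1`. -/
lemma notMem_of_mass (H : IsFront 𝒯 𝒦) (hμ : ∀ v, 0 ≤ μ v) (hm : 1 < mass μ) (hp : bary μ = p)
    (hσ : ∃ σ ∈ 𝒯, μ.support ⊆ σ) {σ' : Finset R3} (hσ' : σ' ∈ 𝒯) : p ∉ σ' := by
  intro h
  obtain ⟨σ, hσ, hs⟩ := hσ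
  have hμσ : WeightsOn σ μ := ⟨hμ, fun v hv => Finsupp.notMem_support_iff.1 fun h => hv (hs h)⟩
  have : μ = Finsupp.single p 1 := by
    refine H.cone_unique σ hσ σ' hσ' _ _ hμσ ⟨fun v => ?_, fun v hv => ?_⟩ (by simp [hp])
    · rw [Finsupp.single_apply]; split_ifs <;> norm_num
    · rw [Finsupp.single_apply, if_neg]
      rintro rfl
      exact hv h
  rw [this] at hm
  simp at hm

/-- The two facts used about a new triangle: substitution of `μ` for `p` sends its cone into a
single old cone, and it omits a vertex of the starred face. The second makes the substitution
injective, see `starFront_apply_le`. -/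
lemma starFront_spec (H : IsFront 𝒯 𝒦) (hμ : ∀ v, 0 ≤ μ v) (hm : 1 < mass μ) (hp : bary μ = p)
    (hσ : ∃ σ ∈ 𝒯, μ.support ⊆ σ) {σ' : Finset R3} (hσ' : σ' ∈ starFront 𝒯 μ.support p) :
    (∃ σ ∈ 𝒯, (∀ w, WeightsOn σ' w → WeightsOn σ (substWeights p μ w)) ∧
      (p ∈ σ' → μ.support ⊆ σ)) ∧
      ∃ i ∈ μ.support, i ∉ σ' := by
  rcases mem_starFront.1 hσ' with ⟨h1, h2⟩ | ⟨σ₀, h1, h2, i, hi, rfl⟩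
  · have hpσ := H.notMem_of_mass hμ hm hp hσ h1
    refine ⟨⟨σ', h1, fun w hw => ?_, fun h => absurd h hpσ⟩, Finset.not_subset.1 h2⟩
    rwa [substWeights_of_zero _ (hw.2 p hpσ)]
  · have hpσ := H.notMem_of_mass hμ hm hp hσ h1
    refine ⟨⟨σ₀, h1, fun w hw => ?_, fun _ => h2⟩, i, hi, ?_⟩
    · exact (hw.mono (Finset.insert_subset_insert _ (Finset.erase_subset _ _))).substWeights hμ
        h2 hpσ
    · simp only [Finset.mem_insert, Finset.mem_erase, ne_eq, not_true_eq_false, false_and, or_false]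
      rintro rfl
      exact hpσ (h2 hi)

/-- In a starred cone, subtract the largest multiple of `μ` that keeps the weights nonnegative and
put that multiple on `p`. The vertex where the minimum ratio is attained drops out. -/
lemma starFront_cover (H : IsFront 𝒯 𝒦) (hμ : ∀ v, 0 ≤ μ v) (hm : 1 < mass μ) (hp : bary μ = p)
    (hσ : ∃ σ ∈ 𝒯, μ.support ⊆ σ) (x : R3) :
    ∃ σ ∈ starFront 𝒯 μ.support p, ∃ w, WeightsOn σ w ∧ bary w = x := by
  obtain ⟨σ, h1, w, hw, rfl⟩ := H.cone_cover x
  by_cases h2 : μ.support ⊆ σ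
  · have hne : μ.support.Nonempty := by
      rw [Finsupp.support_nonempty_iff]
      rintro rfl
      simp at hm
      linarith
    have hpσ := H.notMem_of_mass hμ hm hp hσ h1
    have hμp : μ p = 0 := Finsupp.notMem_support_iff.1 fun h => hpσ (h2 h)
    obtain ⟨i, hi, hmin⟩ := Finset.exists_min_image μ.support (fun i => w i / μ i) hne
    have hip : i ≠ p := by rintro rfl; exact hpσ (h2 hi)
    have hpos : ∀ v ∈ μ.support, 0 < μ v := fun v hv =>
      lt_of_le_of_ne (hμ v) (Finsupp.mem_support_iff.1 hv).symm
    set α := w i / μ i with hα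
    have hα0 : 0 ≤ α := div_nonneg (hw.1 i) (hμ i)
    refine ⟨insert p (σ.erase i), mem_starFront.2 (Or.inr ⟨σ, h1, h2, i, hi, rfl⟩),
      w - α • μ + Finsupp.single p α, ⟨fun v => ?_, fun v hv => ?_⟩, by simp [hp]⟩
    · by_cases hvp : v = p
      · simp [hvp, hμp, hw.2 p hpσ, hα0]
      · simp only [Finsupp.add_apply, Finsupp.sub_apply, Finsupp.smul_apply, smul_eq_mul,
          Finsupp.single_apply, Ne.symm hvp, if_false, add_zero]
        by_cases hv : v ∈ μ.support
        · have := hmin v hv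
          rw [le_div_iff₀ (hpos v hv)] at this
          linarith
        · rw [Finsupp.notMem_support_iff.1 hv]
          simpa using hw.1 v
    · simp only [Finset.mem_insert, Finset.mem_erase, not_or, not_and, ne_eq] at hv
      simp only [Finsupp.add_apply, Finsupp.sub_apply, Finsupp.smul_apply, smul_eq_mul,
          Finsupp.single_apply, Ne.symm hv.1, if_false, add_zero]
      by_cases hvi : v = i
      · subst hvi
        rw [hα, div_mul_cancel₀ _ (hpos v hi).ne', sub_self]
      · have hvσ := hv.2 hvi
        rw [hw.2 v hvσ, Finsupp.notMem_support_iff.1 fun h => hvσ (h2 h)]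
        simp
  · exact ⟨σ, mem_starFront.2 (Or.inl ⟨h1, h2⟩), w, hw, rfl⟩

/-- At a vertex `i` of the starred face missing from `σ'`, the substituted weight is `w p * μ i` on
one side and at least `u p * μ i` on the other. Thus weights on the new fan carry the largest
possible amount of `p`. -/
lemma starFront_apply_le (H : IsFront 𝒯 𝒦) (hμ : ∀ v, 0 ≤ μ v) (hm : 1 < mass μ) (hp : bary μ = p)
    (hσ : ∃ σ ∈ 𝒯, μ.support ⊆ σ) {σ' : Finset R3} (hσ' : σ' ∈ starFront 𝒯 μ.support p)
    {w u : R3 →₀ ℝ} (hw : WeightsOn σ' w) (hu : ∀ v, 0 ≤ u v)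
    (h : substWeights p μ w = substWeights p μ u) : u p ≤ w p := by
  obtain ⟨-, i, hi, hiσ⟩ := H.starFront_spec hμ hm hp hσ hσ'
  have hip : i ≠ p := by
    rintro rfl
    obtain ⟨σ, h1, h2⟩ := hσ
    exact H.notMem_of_mass hμ hm hp ⟨σ, h1, h2⟩ h1 (h2 hi)
  have hpos : 0 < μ i := lt_of_le_of_ne (hμ i) (Finsupp.mem_support_iff.1 hi).symm
  have := DFunLike.congr_fun h i
  rw [substWeights_of_ne _ _ hip, substWeights_of_ne _ _ hip, hw.2 i hiσ, zero_add] at this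
  have h3 := hu i
  exact le_of_mul_le_mul_right (by linarith) hpos

/-- Starring faces of the front with a vertex outside of the body. -/
theorem star (H : IsFront 𝒯 𝒦) (hμ : ∀ v, 0 ≤ μ v) (hm : 1 < mass μ) (hp : bary μ = p)
    (hσ : ∃ σ ∈ 𝒯, μ.support ⊆ σ) :
    IsFront (starFront 𝒯 μ.support p) (starTets 𝒯 𝒦 μ.support p) := by
  have hnot : ∀ σ ∈ 𝒯, p ∉ σ := fun σ h => H.notMem_of_mass hμ hm hp hσ h
  have hcu : ∀ σ ∈ starFront 𝒯 μ.support p, ∀ σ' ∈ starFront 𝒯 μ.support p, ∀ w w',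
      WeightsOn σ w → WeightsOn σ' w' → bary w = bary w' → w = w' := by
    intro σ₁ h₁ σ₂ h₂ w₁ w₂ hw₁ hw₂ he
    obtain ⟨⟨σ, hσ1, hσ2, -⟩, -⟩ := H.starFront_spec hμ hm hp hσ h₁
    obtain ⟨⟨σ', hσ1', hσ2', -⟩, -⟩ := H.starFront_spec hμ hm hp hσ h₂
    have heq := H.cone_unique σ hσ1 σ' hσ1' _ _ (hσ2 _ hw₁) (hσ2' _ hw₂)
      (by rw [bary_substWeights hp, bary_substWeights hp, he])
    exact eq_of_substWeights_eq heq (le_antisymm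
      (H.starFront_apply_le hμ hm hp hσ h₂ hw₂ hw₁.1 heq.symm)
      (H.starFront_apply_le hμ hm hp hσ h₁ hw₁ hw₂.1 heq))
  -- Passing from the old cone to the new one trades `μ` for the lighter unit weight at `p`, so the
  -- mass can only decrease.
  have hbelow : ∀ z, BelowFront 𝒯 z → BelowFront (starFront 𝒯 μ.support p) z := by
    rintro z ⟨σ, h1, w, hw, hz, hmw⟩
    obtain ⟨σ', h1', w', hw', hz'⟩ := H.starFront_cover hμ hm hp hσ z
    refine ⟨σ', h1', w', hw', hz', ?_⟩
    obtain ⟨⟨σ₀, hσ1, hσ2, -⟩, -⟩ := H.starFront_spec hμ hm hp hσ h1'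
    have heq := H.cone_unique _ hσ1 σ h1 _ _ (hσ2 _ hw') hw
      (by rw [bary_substWeights hp, hz, hz'])
    have := mass_substWeights p μ w'
    rw [heq] at this
    nlinarith [mul_nonneg (hw'.1 p) (sub_nonneg.2 hm.le)]
  -- A point of a new tetrahedron with positive weight at `p` has old mass above `1`, so it is
  -- outside the old body. Old and new tetrahedra therefore meet only along the old front.
  have hmix : ∀ s ∈ 𝒦, ∀ σ ∈ 𝒯, μ.support ⊆ σ → ∀ u u', WeightsOn s u →
      WeightsOn (insert p σ) u' → mass u = 1 → mass u' = 1 → bary u = bary u' → u = u' := by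
    intro s hs σ h1 h2 u u' hu hu' hmu hmu' he
    have hw := hu'.substWeights hμ h2 (hnot σ h1)
    have := (H.body σ h1 _ hw).1
      (mem_hullUnion.2 ⟨s, hs, u, hu, hmu, by rw [he, bary_substWeights hp]⟩)
    rw [mass_substWeights, hmu'] at this
    have hp0 : u' p = 0 := by
      refine le_antisymm ?_ (hu'.1 p)
      by_contra hlt
      push Not at hlt
      nlinarith [mul_pos hlt (sub_pos.2 hm)]
    rw [substWeights_of_zero _ hp0] at hw
    obtain ⟨s₀, hs₀, hsub⟩ := H.sub σ h1
    exact H.unique s hs s₀ hs₀ _ _ hu (hw.mono hsub) hmu hmu' he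
  refine ⟨hcu, H.starFront_cover hμ hm hp hσ, ?_, ?_, ?_, ?_, ?_, ?_⟩
  · intro s hs s' hs' u u' hu hu' hmu hmu' he
    rcases mem_starTets.1 hs with h | ⟨σ, h1, h2, rfl⟩ <;>
    rcases mem_starTets.1 hs' with h' | ⟨σ', h1', h2', rfl⟩
    · exact H.unique s h s' h' _ _ hu hu' hmu hmu' he
    · exact hmix s h σ' h1' h2' _ _ hu hu' hmu hmu' he
    · exact (hmix s' h' σ h1 h2 _ _ hu' hu hmu' hmu he.symm).symm
    · have heq := H.cone_unique σ h1 σ' h1' _ _ (hu.substWeights hμ h2 (hnot σ h1))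
        (hu'.substWeights hμ h2' (hnot σ' h1')) (by rw [bary_substWeights hp, bary_substWeights hp, he])
      -- Both masses are `1`, and each unit of weight at `p` adds `mass μ - 1` under substitution;
      -- equal substituted masses force equal weights at `p`.
      refine eq_of_substWeights_eq heq ?_
      have := congrArg mass heq
      rw [mass_substWeights, mass_substWeights, hmu, hmu'] at this
      exact mul_right_cancel₀ (sub_pos.2 hm).ne' (by linarith)
  · intro σ' hσ' w hw
    obtain ⟨⟨σ₁, hσ1, hσ2, hσ3⟩, -⟩ := H.starFront_spec hμ hm hp hσ hσ'
    have hF := hσ2 _ hw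
    have hmF := mass_substWeights p μ w
    have hm0 := sub_pos.2 hm
    constructor
    · intro hx
      obtain ⟨s, hs, u, hu, hmu, hb⟩ := mem_hullUnion.1 hx
      rcases mem_starTets.1 hs with h | ⟨σ, h1, h2, rfl⟩
      · have := (H.body σ₁ hσ1 _ hF).1
          (mem_hullUnion.2 ⟨s, h, u, hu, hmu, by rw [bary_substWeights hp, hb]⟩)
        nlinarith [mul_nonneg (hw.1 p) hm0.le]
      · have heq := H.cone_unique σ₁ hσ1 σ h1 _ _ hF (hu.substWeights hμ h2 (hnot σ h1))
          (by rw [bary_substWeights hp, bary_substWeights hp, hb])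
        have hle := H.starFront_apply_le hμ hm hp hσ hσ' hw hu.1 heq
        have := congrArg mass heq
        rw [mass_substWeights, mass_substWeights, hmu] at this
        nlinarith [mul_nonneg (sub_nonneg.2 hle) hm0.le]
    · intro hle
      by_cases hF1 : mass (substWeights p μ w) ≤ 1
      · have := (H.body σ₁ hσ1 _ hF).2 hF1
        rw [bary_substWeights hp] at this
        obtain ⟨s, hs, hx⟩ := mem_hullUnion.1 this
        exact mem_hullUnion.2 ⟨s, mem_starTets.2 (Or.inl hs), hx⟩
      · push Not at hF1
        have hwp : 0 < w p := by
          by_contra hneg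
          push Not at hneg
          nlinarith [mul_nonneg (sub_nonneg.2 hneg) hm0.le]
        have hpσ' : p ∈ σ' := by
          by_contra h
          exact hwp.ne' (hw.2 p h)
        have hsub := hσ3 hpσ'
        have hpσ := hnot σ₁ hσ1
        have hμp : μ p = 0 := Finsupp.notMem_support_iff.1 fun h => hpσ (hsub h)
        -- The amount of `p` for which trading `α • μ` for `p` lowers the mass of the substituted
        -- weights to exactly `1`.
        set α := (mass (substWeights p μ w) - 1) / (mass μ - 1) with hα
        have hαm : α * (mass μ - 1) = mass (substWeights p μ w) - 1 := div_mul_cancel₀ _ hm0.ne'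
        have hα0 : 0 ≤ α := div_nonneg (by linarith) hm0.le
        have hαp : α ≤ w p := by
          rw [hα, div_le_iff₀ hm0]
          linarith
        refine mem_hullUnion.2 ⟨insert p σ₁, mem_starTets.2 (Or.inr ⟨σ₁, hσ1, hsub, rfl⟩),
          substWeights p μ w - α • μ + Finsupp.single p α, ⟨fun v => ?_, fun v hv => ?_⟩, ?_, ?_⟩
        · by_cases hvp : v = p
          · simp [hvp, hμp, substWeights_self hμp, hα0]
          · simp only [Finsupp.add_apply, Finsupp.sub_apply, Finsupp.smul_apply, smul_eq_mul,
              Finsupp.single_apply, Ne.symm hvp, if_false, add_zero, substWeights_of_ne _ _ hvp]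
            nlinarith [mul_nonneg (sub_nonneg.2 hαp) (hμ v), hw.1 v]
        · simp only [Finset.mem_insert, not_or] at hv
          simp [Ne.symm hv.1, hF.2 v hv.2,
            Finsupp.notMem_support_iff.1 fun h => hv.2 (hsub h)]
        · simp only [map_add, map_sub, map_smul, mass_single, smul_eq_mul]
          linarith
        · simp [hp, bary_substWeights hp]
  · intro σ' hσ'
    rcases mem_starFront.1 hσ' with ⟨h1, -⟩ | ⟨σ₀, h1, h2, i, -, rfl⟩
    · obtain ⟨s, hs, hsub⟩ := H.sub σ' h1
      exact ⟨s, mem_starTets.2 (Or.inl hs), hsub⟩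
    · exact ⟨insert p σ₀, mem_starTets.2 (Or.inr ⟨σ₀, h1, h2, rfl⟩),
        Finset.insert_subset_insert _ (Finset.erase_subset _ _)⟩
  · have hne : μ.support.Nonempty := by
      rw [Finsupp.support_nonempty_iff]
      rintro rfl
      simp at hm
      linarith
    have hpin : ∃ σ ∈ starFront 𝒯 μ.support p, p ∈ σ := by
      obtain ⟨σ, h1, h2⟩ := hσ
      obtain ⟨i, hi⟩ := hne
      exact ⟨_, mem_starFront.2 (Or.inr ⟨σ, h1, h2, i, hi, rfl⟩), Finset.mem_insert_self _ _⟩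
    have hold : ∀ σ ∈ 𝒯, ∀ z ∈ σ, (∃ σ' ∈ starFront 𝒯 μ.support p, z ∈ σ') ∨
        BelowFront (starFront 𝒯 μ.support p) z := by
      intro σ h1 z hz
      by_cases h2 : μ.support ⊆ σ
      · by_cases hi : ∃ i ∈ μ.support, i ≠ z
        · obtain ⟨i, hi, hiz⟩ := hi
          exact Or.inl ⟨_, mem_starFront.2 (Or.inr ⟨σ, h1, h2, i, hi, rfl⟩),
            Finset.mem_insert_of_mem (Finset.mem_erase.2 ⟨hiz.symm, hz⟩)⟩
        -- Here the starred face is the single vertex `z`, so `p` is a multiple of `z` by a factor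
        -- above `1`: `z` leaves the front and ends up strictly below it.
        · push Not at hi
          have hμz : μ = Finsupp.single z (μ z) := by
            ext v
            by_cases hv : v = z
            · simp [hv]
            · rw [Finsupp.single_apply, if_neg (Ne.symm hv)]
              exact Finsupp.notMem_support_iff.1 fun h => hv (hi v h)
          have hmz : mass μ = μ z := by rw [hμz]; simp
          have hpz : p = μ z • z := by rw [← hp, hμz]; simp
          obtain ⟨σ', h1', hpσ'⟩ := hpin
          have hz0 : 0 < μ z := by linarith
          refine Or.inr ⟨σ', h1', Finsupp.single p (μ z)⁻¹, ⟨fun v => ?_, fun v hv => ?_⟩, ?_, ?_⟩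
          · rw [Finsupp.single_apply]; split_ifs <;> positivity
          · rw [Finsupp.single_apply, if_neg]
            rintro rfl
            exact hv hpσ'
          · rw [bary_single, hpz, smul_smul, inv_mul_cancel₀ hz0.ne', one_smul]
          · rw [mass_single]
            exact inv_lt_one_of_one_lt₀ (by linarith)
      · exact Or.inl ⟨σ, mem_starFront.2 (Or.inl ⟨h1, h2⟩), hz⟩
    intro s hs z hz
    rcases mem_starTets.1 hs with h | ⟨σ, h1, h2, rfl⟩
    · rcases H.vert s h z hz with ⟨σ, h1, hzσ⟩ | hb
      exacts [hold σ h1 z hzσ, Or.inr (hbelow z hb)]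
    · rcases Finset.mem_insert.1 hz with rfl | hz
      exacts [Or.inl hpin, hold σ h1 z hz]
  · intro σ' hσ'
    rcases mem_starFront.1 hσ' with ⟨h1, -⟩ | ⟨σ₀, h1, h2, i, hi, rfl⟩
    · exact H.card_front σ' h1
    · rw [Finset.card_insert_of_notMem fun h => hnot σ₀ h1 (Finset.mem_of_mem_erase h),
        Finset.card_erase_of_mem (h2 hi), H.card_front σ₀ h1]
  · intro s hs
    rcases mem_starTets.1 hs with h | ⟨σ, h1, h2, rfl⟩
    · exact H.card_tet s h
    · rw [Finset.card_insert_of_notMem (hnot σ h1), H.card_front σ h1]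

end IsFront

end Front

/-! ### From unique weights to simplicial complexes; topology of the body. -/

section Complex

open scoped Classical

/-- Convex representations by vertices of a member of `𝒦` are unique. -/
def UniqueWeights (𝒦 : Finset (Finset R3)) : Prop :=
  ∀ s ∈ 𝒦, ∀ s' ∈ 𝒦, ∀ u u', WeightsOn s u → WeightsOn s' u' → mass u = 1 → mass u' = 1 →
    bary u = bary u' → u = u'

/-- An affine dependence on `t` could be added, scaled by a small `ε`, to the uniform weights on
`t`; this would give a second convex representation of the centroid. -/
lemma UniqueWeights.affineIndependent {𝒦 : Finset (Finset R3)} (h : UniqueWeights 𝒦)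
    {s t : Finset R3} (ht : t ∈ 𝒦) (hst : s ⊆ t) : AffineIndependent ℝ ((↑) : s → R3) := by
  rw [affineIndependent_iff]
  intro I w h0 hb e he
  set W : R3 →₀ ℝ := ∑ i ∈ I, Finsupp.single (i : R3) (w i) with hW
  have hWe : W e = w e := by
    rw [hW, Finsupp.finsetSum_apply, Finset.sum_eq_single e]
    · simp
    · intro i _ hi
      rw [Finsupp.single_apply, if_neg fun h => hi (Subtype.ext h)]
    · exact fun h => absurd he h
  have hW0 : ∀ v ∉ t, W v = 0 := fun v hv => by
    rw [hW, Finsupp.finsetSum_apply]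
    refine Finset.sum_eq_zero fun i _ => ?_
    rw [Finsupp.single_apply, if_neg]
    rintro rfl
    exact hv (hst i.2)
  have hmW : mass W = 0 := by simp [hW, h0]
  have hbW : bary W = 0 := by simp [hW, hb]
  have hcard : 0 < (t.card : ℝ) := by
    exact_mod_cast Finset.card_pos.2 ⟨(e : R3), hst e.2⟩
  set B : ℝ := 1 + ∑ v ∈ t, |W v| with hB
  have hBv : ∀ v, |W v| ≤ B := fun v => by
    by_cases hv : v ∈ t
    · have := Finset.single_le_sum (f := fun v => |W v|) (fun i _ => abs_nonneg _) hv
      linarith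
    · rw [hW0 v hv, abs_zero]
      have := Finset.sum_nonneg (s := t) (f := fun v => |W v|) fun i _ => abs_nonneg _
      linarith
  have hB0 : 0 < B := by
    have := Finset.sum_nonneg (s := t) (f := fun v => |W v|) fun i _ => abs_nonneg _
    linarith
  set u : R3 →₀ ℝ := Finsupp.indicator t fun _ _ => (t.card : ℝ)⁻¹ with hu
  set ε : ℝ := (t.card : ℝ)⁻¹ / B with hε
  have hε0 : 0 < ε := by positivity
  have hu0 : ∀ v ∉ t, u v = 0 := fun v hv => by simp [hu, Finsupp.indicator_apply, hv]
  have hut : ∀ v ∈ t, u v = (t.card : ℝ)⁻¹ := fun v hv => by simp [hu, Finsupp.indicator_apply, hv]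
  have hmu : mass u = 1 := by
    rw [mass_eq_sum hu0, Finset.sum_congr rfl hut, Finset.sum_const, nsmul_eq_mul,
      mul_inv_cancel₀ hcard.ne']
  have key : u + ε • W = u := by
    refine h t ht t ht _ _ ⟨fun v => ?_, fun v hv => ?_⟩ ⟨fun v => ?_, hu0⟩ (by simp [hmu, hmW]) hmu
      (by simp [hbW])
    · by_cases hv : v ∈ t
      · have h1 := neg_le_of_abs_le (hBv v)
        have h2 : ε * B = (t.card : ℝ)⁻¹ := div_mul_cancel₀ _ hB0.ne'
        simp only [Finsupp.add_apply, Finsupp.smul_apply, smul_eq_mul, hut v hv]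
        nlinarith
      · simp [hu0 v hv, hW0 v hv]
    · simp [hu0 v hv, hW0 v hv]
    · by_cases hv : v ∈ t
      · rw [hut v hv]; positivity
      · rw [hu0 v hv]
  have := DFunLike.congr_fun (add_eq_left.1 key) (e : R3)
  simp only [Finsupp.smul_apply, smul_eq_mul, Finsupp.coe_zero, Pi.zero_apply, mul_eq_zero,
    hε0.ne', false_or, hWe] at this
  exact this

/-- The simplicial complex whose maximal simplices are the members of `𝒦`. -/
def UniqueWeights.complex {𝒦 : Finset (Finset R3)} (h : UniqueWeights 𝒦) :
    Geometry.SimplicialComplex ℝ R3 where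
  faces := {s | s.Nonempty ∧ ∃ t ∈ 𝒦, s ⊆ t}
  isRelLowerSet_faces := by
    rintro s ⟨hs, t, ht, hst⟩
    exact ⟨hs, fun s' hs' hne => ⟨hne, t, ht, hs'.trans hst⟩⟩
  indep := by
    rintro s ⟨-, t, ht, hst⟩
    exact h.affineIndependent ht hst
  inter_subset_convexHull := by
    rintro s s' ⟨-, t, ht, hst⟩ ⟨-, t', ht', hst'⟩ x ⟨hx, hx'⟩
    obtain ⟨u, hu, hm, rfl⟩ := mem_convexHull_iff_weightsOn.1 hx
    obtain ⟨u', hu', hm', he⟩ := mem_convexHull_iff_weightsOn.1 hx'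
    -- The two representations of the common point coincide, so they are supported on the common
    -- vertices.
    obtain rfl := h t ht t' ht' u u' (hu.mono hst) (hu'.mono hst') hm hm' he.symm
    rw [← Finset.coe_inter]
    refine mem_convexHull_iff_weightsOn.2 ⟨u, ⟨hu.1, fun v hv => ?_⟩, hm, rfl⟩
    by_cases hvs : v ∈ s
    · exact hu'.2 v fun h => hv (Finset.mem_inter.2 ⟨hvs, h⟩)
    · exact hu.2 v hvs

namespace UniqueWeights

variable {𝒦 : Finset (Finset R3)} (h : UniqueWeights 𝒦)

lemma finite_faces : h.complex.faces.Finite := by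
  refine (𝒦.biUnion Finset.powerset).finite_toSet.subset ?_
  rintro s ⟨-, t, ht, hst⟩
  simp only [Finset.coe_biUnion, mem_iUnion, Finset.mem_coe, Finset.mem_powerset]
  exact ⟨t, ht, hst⟩

lemma space_complex : h.complex.space = hullUnion 𝒦 := by
  ext x
  rw [Geometry.SimplicialComplex.mem_space_iff]
  simp only [hullUnion, mem_iUnion]
  constructor
  · rintro ⟨s, ⟨-, t, ht, hst⟩, hx⟩
    exact ⟨t, ht, convexHull_mono (by exact_mod_cast hst) hx⟩
  · rintro ⟨t, ht, hx⟩
    have hne : t.Nonempty := by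
      have := convexHull_nonempty_iff.1 ⟨x, hx⟩
      exact_mod_cast this
    exact ⟨t, ⟨hne, t, ht, subset_rfl⟩, hx⟩

lemma tetrahedra_complex (hc : ∀ s ∈ 𝒦, s.card = 4) : tetrahedra h.complex = 𝒦 := by
  ext s
  constructor
  · rintro ⟨⟨-, t, ht, hst⟩, h4⟩
    rw [Finset.eq_of_subset_of_card_le hst (by rw [hc t ht, h4])]
    exact ht
  · intro hs
    refine ⟨⟨?_, s, hs, subset_rfl⟩, hc s hs⟩
    rw [← Finset.card_pos, hc s hs]
    norm_num

lemma mem_vertices_complex {z : R3} : z ∈ h.complex.vertices ↔ ∃ t ∈ 𝒦, z ∈ t := by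
  rw [Geometry.SimplicialComplex.mem_vertices]
  constructor
  · rintro ⟨-, t, ht, hz⟩
    exact ⟨t, ht, Finset.singleton_subset_iff.1 hz⟩
  · rintro ⟨t, ht, hz⟩
    exact ⟨Finset.singleton_nonempty z, t, ht, Finset.singleton_subset_iff.2 hz⟩

end UniqueWeights

/-- The family `𝒦` translated by `x₀`. -/
noncomputable def translateTets (x₀ : R3) (𝒦 : Finset (Finset R3)) : Finset (Finset R3) :=
  𝒦.image fun s => s.image fun v => v + x₀

lemma mem_translateTets {x₀ : R3} {𝒦 : Finset (Finset R3)} {s : Finset R3} :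
    s ∈ translateTets x₀ 𝒦 ↔ ∃ s₀ ∈ 𝒦, s = s₀.image fun v => v + x₀ := by
  simp [translateTets, eq_comm]

lemma convexHull_image_add (x₀ : R3) (s : Finset R3) :
    convexHull ℝ ((s.image fun v => v + x₀ : Finset R3) : Set R3) =
      (fun v => v + x₀) '' convexHull ℝ (s : Set R3) := by
  rw [Finset.coe_image]
  have : (fun v : R3 => v + x₀) = (x₀ +ᵥ ·) := funext fun v => add_comm v x₀
  rw [this, image_vadd, image_vadd]
  exact convexHull_vadd x₀ (s : Set R3)

lemma hullUnion_translateTets (x₀ : R3) (𝒦 : Finset (Finset R3)) :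
    hullUnion (translateTets x₀ 𝒦) = (fun v => v + x₀) '' hullUnion 𝒦 := by
  simp only [hullUnion, translateTets, image_iUnion, Finset.set_biUnion_finset_image,
    convexHull_image_add]

lemma UniqueWeights.translate {𝒦 : Finset (Finset R3)} (h : UniqueWeights 𝒦) (x₀ : R3) :
    UniqueWeights (translateTets x₀ 𝒦) := by
  have key : ∀ (s : Finset R3) (u : R3 →₀ ℝ), WeightsOn (s.image fun v => v + x₀) u →
      WeightsOn s (Finsupp.equivMapDomain (Equiv.subRight x₀) u) ∧
      mass (Finsupp.equivMapDomain (Equiv.subRight x₀) u) = mass u ∧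
      bary (Finsupp.equivMapDomain (Equiv.subRight x₀) u) = bary u - mass u • x₀ := by
    intro s u hu
    refine ⟨⟨fun v => ?_, fun v hv => ?_⟩, ?_, ?_⟩
    · rw [Finsupp.equivMapDomain_apply]; exact hu.1 _
    · rw [Finsupp.equivMapDomain_apply]
      refine hu.2 _ fun h => hv ?_
      obtain ⟨v', hv', he⟩ := Finset.mem_image.1 h
      have : v' = v := by simpa using he
      rwa [← this]
    · rw [Finsupp.equivMapDomain_eq_mapDomain, mass, Finsupp.linearCombination_mapDomain]
      rfl
    · rw [Finsupp.equivMapDomain_eq_mapDomain, mass, bary, Finsupp.linearCombination_mapDomain,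
        Finsupp.linearCombination_apply, Finsupp.linearCombination_apply,
        Finsupp.linearCombination_apply, Finsupp.sum, Finsupp.sum, Finsupp.sum, Finset.sum_smul,
        ← Finset.sum_sub_distrib]
      exact Finset.sum_congr rfl fun v _ => by simp [smul_sub]
  intro s hs s' hs' u u' hu hu' hm hm' he
  obtain ⟨t, ht, rfl⟩ := mem_translateTets.1 hs
  obtain ⟨t', ht', rfl⟩ := mem_translateTets.1 hs'
  obtain ⟨a1, a2, a3⟩ := key t u hu
  obtain ⟨b1, b2, b3⟩ := key t' u' hu'
  have := h t ht t' ht' _ _ a1 b1 (a2.trans hm) (b2.trans hm') (by rw [a3, b3, he, hm, hm'])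
  ext v
  have := DFunLike.congr_fun this (v - x₀)
  simpa [Finsupp.equivMapDomain_apply] using this

namespace IsFront

variable {𝒯 𝒦 : Finset (Finset R3)}

/-- A point is on or beyond the front iff some scaling by `t ∈ [0, 1]` brings it onto a front
triangle. The set of such pairs is closed, and projecting away the compact parameter `t` is a closed
map. -/
lemma isClosed_not_belowFront (H : IsFront 𝒯 𝒦) : IsClosed {x | ¬ BelowFront 𝒯 x} := by
  have hcl : IsClosed (hullUnion 𝒯) :=
    (𝒯.finite_toSet.isCompact_biUnion fun s _ =>
      s.finite_toSet.isCompact_convexHull ℝ).isClosed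
  have hcl2 : IsClosed {q : Icc (0 : ℝ) 1 × R3 | (q.1 : ℝ) • q.2 ∈ hullUnion 𝒯} :=
    hcl.preimage (by fun_prop)
  convert! isClosedMap_snd_of_compactSpace _ hcl2 using 1
  ext x
  simp only [mem_image, mem_ofPred_eq, Prod.exists, exists_eq_right, mem_hullUnion]
  constructor
  · intro hx
    obtain ⟨σ, hσ, w, hw, rfl⟩ := H.cone_cover x
    have h1 : 1 ≤ mass w := by
      by_contra h
      exact hx ⟨σ, hσ, w, hw, rfl, not_le.1 h⟩
    have h0 : 0 < mass w := by linarith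
    refine ⟨⟨(mass w)⁻¹, by positivity, inv_le_one_of_one_le₀ h1⟩, σ, hσ, (mass w)⁻¹ • w,
      ⟨fun v => ?_, fun v hv => ?_⟩, ?_, ?_⟩
    · have := hw.1 v
      simp only [Finsupp.smul_apply, smul_eq_mul]
      positivity
    · simp [hw.2 v hv]
    · simp [h0.ne']
    · simp
  · rintro ⟨⟨t, ht0, ht1⟩, σ, hσ, v, hv, hm, hb⟩ ⟨σ', hσ', w, hw, rfl, hlt⟩
    have := H.cone_unique σ hσ σ' hσ' v (t • w) hv ⟨fun v => ?_, fun v hv => ?_⟩ (by simp [hb])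
    · have h2 := hw.mass_nonneg
      rw [this, map_smul, smul_eq_mul] at hm
      nlinarith
    · have := hw.1 v
      simp only [Finsupp.smul_apply, smul_eq_mul]
      positivity
    · simp [hw.2 v hv]

lemma belowFront_smul {x : R3} (hx : BelowFront 𝒯 x) {t : ℝ} (h0 : 0 ≤ t) (h1 : t ≤ 1) :
    BelowFront 𝒯 (t • x) := by
  obtain ⟨σ, hσ, w, hw, rfl, hlt⟩ := hx
  refine ⟨σ, hσ, t • w, ⟨fun v => ?_, fun v hv => ?_⟩, by simp, ?_⟩
  · have := hw.1 v
    simp only [Finsupp.smul_apply, smul_eq_mul]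
    positivity
  · simp [hw.2 v hv]
  · have := hw.mass_nonneg
    simp only [map_smul, smul_eq_mul]
    nlinarith

lemma belowFront_zero (H : IsFront 𝒯 𝒦) : BelowFront 𝒯 0 := by
  obtain ⟨σ, hσ, -⟩ := H.cone_cover 0
  exact ⟨σ, hσ, 0, ⟨fun _ => le_rfl, fun _ _ => rfl⟩, by simp, by simp⟩

/-- An interior point can be pushed outward by some `t > 1` within the body, so its own mass is at
most `t⁻¹ < 1`. Conversely, the points below the front form an open subset of the body. -/
lemma interior_hullUnion (H : IsFront 𝒯 𝒦) : interior (hullUnion 𝒦) = {x | BelowFront 𝒯 x} := by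
  refine Subset.antisymm (fun x hx => ?_) (interior_maximal ?_ ?_)
  · have hc : Tendsto (fun t : ℝ => t • x) (𝓝[>] 1) (𝓝 x) := by
      have : ContinuousAt (fun t : ℝ => t • x) 1 := by fun_prop
      have h2 := this.tendsto
      rw [one_smul] at h2
      exact h2.mono_left nhdsWithin_le_nhds
    obtain ⟨t, ht, ht1⟩ := ((hc.eventually (mem_interior_iff_mem_nhds.1 hx)).and
      self_mem_nhdsWithin).exists
    obtain ⟨σ, hσ, w, hw, hb⟩ := H.cone_cover (t • x)
    have ht1 : 1 < t := ht1
    have hle := (H.body σ hσ w hw).1 (by rw [hb]; exact ht)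
    have ht0 : 0 < t := by linarith
    refine ⟨σ, hσ, t⁻¹ • w, ⟨fun v => ?_, fun v hv => ?_⟩, ?_, ?_⟩
    · have := hw.1 v
      simp only [Finsupp.smul_apply, smul_eq_mul]
      positivity
    · simp [hw.2 v hv]
    · simp [hb, ht0.ne']
    · have h3 := hw.mass_nonneg
      simp only [map_smul, smul_eq_mul]
      calc t⁻¹ * mass w ≤ t⁻¹ * 1 := by gcongr
        _ < 1 := by rw [mul_one]; exact inv_lt_one_of_one_lt₀ ht1
  · rintro x ⟨σ, hσ, w, hw, rfl, hlt⟩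
    exact (H.body σ hσ w hw).2 hlt.le
  · have := H.isClosed_not_belowFront.isOpen_compl
    simpa [compl_ofPred] using this

lemma isConnected_interior (H : IsFront 𝒯 𝒦) : IsConnected (interior (hullUnion 𝒦)) := by
  rw [H.interior_hullUnion]
  have h : StarConvex ℝ 0 {x | BelowFront 𝒯 x} := by
    rw [starConvex_zero_iff]
    exact fun x hx t h0 h1 => belowFront_smul hx h0 h1
  exact (h.isPathConnected H.belowFront_zero).isConnected

/-- The body of a front, translated by `x₀`, is triangulated by its tetrahedra. -/
lemma isTriangulation (H : IsFront 𝒯 𝒦) (x₀ : R3)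
    (hU : UniqueWeights (translateTets x₀ 𝒦)) :
    IsTriangulation hU.complex ((fun v => v + x₀) '' interior (hullUnion 𝒦)) := by
  have hc : ∀ s ∈ translateTets x₀ 𝒦, s.card = 4 := by
    intro s hs
    obtain ⟨t, ht, rfl⟩ := mem_translateTets.1 hs
    rw [Finset.card_image_of_injective _ (add_left_injective x₀), H.card_tet t ht]
  refine ⟨hU.finite_faces, ?_, ?_, H.isConnected_interior.image _ (by fun_prop)⟩
  · rintro s ⟨-, t, ht, hst⟩
    exact ⟨t, by rw [hU.tetrahedra_complex hc]; exact ht, hst⟩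
  · rw [hU.space_complex, hullUnion_translateTets]
    exact (Homeomorph.addRight x₀).image_interior _

end IsFront

end Complex

/-! ### Shape regularity from a determinant bound. -/

section Quality

/-- The determinant of three vectors. -/
def det3 (x y z : R3) : ℝ :=
  x 0 * (y 1 * z 2 - y 2 * z 1) - x 1 * (y 0 * z 2 - y 2 * z 0) + x 2 * (y 0 * z 1 - y 1 * z 0)

lemma abs_det3_le (x y z : R3) : |det3 x y z| ≤ 6 * (‖x‖ * ‖y‖ * ‖z‖) := by
  have hc : ∀ (v : R3) (i : Fin 3), |v i| ≤ ‖v‖ := fun v i => by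
    simpa using PiLp.norm_apply_le v i
  have h : ∀ i j k : Fin 3, |x i * (y j * z k)| ≤ ‖x‖ * ‖y‖ * ‖z‖ := fun i j k => by
    rw [abs_mul, abs_mul, ← mul_assoc]
    gcongr <;> exact hc _ _
  have h1 := abs_le.1 (h 0 1 2)
  have h2 := abs_le.1 (h 0 2 1)
  have h3 := abs_le.1 (h 1 0 2)
  have h4 := abs_le.1 (h 1 2 0)
  have h5 := abs_le.1 (h 2 0 1)
  have h6 := abs_le.1 (h 2 1 0)
  rw [det3, abs_le]
  constructor <;> nlinarith [h1.1, h1.2]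

/-- Cramer's rule, free of division. -/
lemma det3_smul_eq (x y z v : R3) :
    det3 x y z • v = det3 v y z • x + det3 x v z • y + det3 x y v • z := by
  ext i
  fin_cases i <;> simp [det3] <;> ring

/-- The volume of the tetrahedron added by starring is that of the cone over the old triangle times
the excess of the mass over `1`. -/
lemma det3_sub_combination (A B C : R3) (α β γ : ℝ) :
    det3 (A - (α • A + β • B + γ • C)) (B - (α • A + β • B + γ • C))
      (C - (α • A + β • B + γ • C)) = (1 - (α + β + γ)) * det3 A B C := by
  simp only [det3, PiLp.sub_apply, PiLp.add_apply, PiLp.smul_apply, smul_eq_mul]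
  ring

lemma det3_smul (A B C : R3) (α β γ : ℝ) :
    det3 (α • A) (β • B) (γ • C) = α * β * γ * det3 A B C := by
  simp only [det3, PiLp.smul_apply, smul_eq_mul]
  ring

/-- The simplex with vertices in `s` has diameter at most `D`, and it contains a ball whose radius
is at least its diameter divided by `κ`. -/
def IsGoodSimplex (κ D : ℝ) (s : Finset R3) : Prop :=
  (∃ (x : R3) (r : ℝ), 0 < r ∧ Metric.closedBall x r ⊆ convexHull ℝ (s : Set R3) ∧
    Metric.diam (convexHull ℝ (s : Set R3)) ≤ κ * r) ∧
  Metric.diam (convexHull ℝ (s : Set R3)) ≤ D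

lemma IsGoodSimplex.mono {κ D D' : ℝ} {s : Finset R3} (h : IsGoodSimplex κ D s) (hD : D ≤ D') :
    IsGoodSimplex κ D' s :=
  ⟨h.1, h.2.trans hD⟩

-- The ball is centred at the centroid, where all barycentric coordinates are `1 / 4`. By Cramer's
-- rule and `abs_det3_le`, a displacement of length `θ * D / 72` changes three of them by at most `1
-- / 12` each, hence the fourth by at most `1 / 4`, so all stay nonnegative.
open scoped Classical in
lemma isGoodSimplex_of_det {p A B C : R3} {D θ : ℝ} (hD : 0 < D) (hθ : 0 < θ)
    (h1 : ‖A - p‖ ≤ D) (h2 : ‖B - p‖ ≤ D) (h3 : ‖C - p‖ ≤ D) (h4 : ‖A - B‖ ≤ D)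
    (h5 : ‖A - C‖ ≤ D) (h6 : ‖B - C‖ ≤ D)
    (hdet : θ * D ^ 3 ≤ |det3 (A - p) (B - p) (C - p)|) :
    IsGoodSimplex (72 / θ) D {p, A, B, C} := by
  have hdiam : Metric.diam (convexHull ℝ (({p, A, B, C} : Finset R3) : Set R3)) ≤ D := by
    rw [convexHull_diam]
    refine Metric.diam_le_of_forall_dist_le hD.le ?_
    simp only [Finset.coe_insert, Finset.coe_singleton, mem_insert_iff, mem_singleton_iff]
    rintro x (rfl | rfl | rfl | rfl) y (rfl | rfl | rfl | rfl) <;>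
    first
    | (rw [dist_self]; exact hD.le)
    | (rw [dist_eq_norm]; assumption)
    | (rw [dist_comm, dist_eq_norm]; assumption)
  set e₁ := A - p
  set e₂ := B - p
  set e₃ := C - p
  set Δ := det3 e₁ e₂ e₃ with hΔ
  have hΔ0 : 0 < |Δ| := lt_of_lt_of_le (by positivity) hdet
  have hΔne : Δ ≠ 0 := abs_pos.1 hΔ0
  refine ⟨⟨p + (1 / 4 : ℝ) • (e₁ + e₂ + e₃), θ * D / 72, by positivity, fun y hy => ?_, ?_⟩, hdiam⟩
  · obtain ⟨d, rfl⟩ : ∃ d, y = p + (1 / 4 : ℝ) • (e₁ + e₂ + e₃) + d :=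
      ⟨y - (p + (1 / 4 : ℝ) • (e₁ + e₂ + e₃)), by abel⟩
    have hd : ‖d‖ ≤ θ * D / 72 := by simpa using hy
    have hsmall : ∀ x y z : R3, |det3 x y z| ≤ 6 * (θ * D / 72 * D * D) →
        |det3 x y z / Δ| ≤ 1 / 12 := fun x y z h => by
      rw [abs_div, div_le_iff₀ hΔ0]
      nlinarith
    have a1 := hsmall d e₂ e₃ ((abs_det3_le _ _ _).trans (by gcongr))
    have a2 := hsmall e₁ d e₃ ((abs_det3_le _ _ _).trans (by
      rw [mul_comm ‖e₁‖]; gcongr))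
    have a3 := hsmall e₁ e₂ d ((abs_det3_le _ _ _).trans (by
      rw [show ‖e₁‖ * ‖e₂‖ * ‖d‖ = ‖d‖ * ‖e₁‖ * ‖e₂‖ by ring]; gcongr))
    set x₁ := det3 d e₂ e₃ / Δ
    set x₂ := det3 e₁ d e₃ / Δ
    set x₃ := det3 e₁ e₂ d / Δ
    have hd' : d = x₁ • e₁ + x₂ • e₂ + x₃ • e₃ := by
      have := det3_smul_eq e₁ e₂ e₃ d
      calc d = Δ⁻¹ • (Δ • d) := by rw [smul_smul, inv_mul_cancel₀ hΔne, one_smul]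
        _ = _ := by
          rw [hΔ, this, smul_add, smul_add, smul_smul, smul_smul, smul_smul]
          simp only [x₁, x₂, x₃, div_eq_inv_mul, hΔ]
    rw [abs_le] at a1 a2 a3
    have hconv := (convex_convexHull ℝ (({p, A, B, C} : Finset R3) : Set R3)).sum_mem
      (t := Finset.univ) (w := ![1 - (1 / 4 + x₁) - (1 / 4 + x₂) - (1 / 4 + x₃), 1 / 4 + x₁,
        1 / 4 + x₂, 1 / 4 + x₃]) (z := ![p, A, B, C]) (by
          intro i _
          fin_cases i <;> simp <;> linarith [a1.1, a1.2, a2.1, a2.2, a3.1, a3.2])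
        (by simp [Fin.sum_univ_four]; ring)
        (by
          intro i _
          apply subset_convexHull
          fin_cases i <;> simp)
    convert hconv using 1
    rw [hd']
    simp only [Fin.sum_univ_four, Matrix.cons_val, e₁, e₂, e₃]
    module
  · calc _ ≤ D := hdiam
      _ = _ := by field_simp

/-! ### Gauges and points of prescribed height. -/

/-- A positively homogeneous, subadditive function that is comparable to the norm. -/
structure IsGauge (g : R3 → ℝ) (K : ℝ) : Prop where
  one_le : 1 ≤ K
  add_le : ∀ x y, g (x + y) ≤ g x + g y
  smul : ∀ t : ℝ, 0 ≤ t → ∀ x, g (t • x) = t * g x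
  le_norm : ∀ x, g x ≤ K * ‖x‖
  norm_le : ∀ x, ‖x‖ ≤ K * g x

lemma IsGauge.abs_sub_le {g : R3 → ℝ} {K : ℝ} (hg : IsGauge g K) (x y : R3) :
    |g x - g y| ≤ K * ‖x - y‖ := by
  have h1 := hg.add_le (x - y) y
  have h2 := hg.add_le (y - x) x
  rw [sub_add_cancel] at h1 h2
  have h3 := hg.le_norm (x - y)
  have h4 := hg.le_norm (y - x)
  rw [norm_sub_rev] at h4
  rw [abs_le]
  constructor <;> linarith

lemma IsGauge.pos {g : R3 → ℝ} {K : ℝ} (hg : IsGauge g K) {x : R3} (hx : 0 < ‖x‖) : 0 < g x := by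
  have h := hg.norm_le x
  have hK := hg.one_le
  by_contra hneg
  nlinarith [not_lt.1 hneg]

/-- The point at height `t` (measured by `g`) in direction `v`. -/
noncomputable def pt (g : R3 → ℝ) (t : ℝ) (v : R3) : R3 := (t / g v) • v

lemma IsGauge.apply_pt {g : R3 → ℝ} {K : ℝ} (hg : IsGauge g K) {t : ℝ} (ht : 0 ≤ t) {v : R3}
    (hv : 0 < ‖v‖) : g (pt g t v) = t := by
  have := hg.pos hv
  rw [pt, hg.smul _ (by positivity), div_mul_cancel₀ _ this.ne']

/-- Change the height, then the direction, then the normalising factor `(g a)⁻¹`. The first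
contributes `K * |t - t'|`; the other two contribute `2 * K` and `4 * K ^ 3` times `t' * ‖a - b‖`.
-/
lemma IsGauge.norm_pt_sub_le {g : R3 → ℝ} {K : ℝ} (hg : IsGauge g K) {t t' : ℝ} {a b : R3}
    (ht' : 0 ≤ t') (ha : 1 / 2 ≤ ‖a‖) (hb : 1 / 2 ≤ ‖b‖) (hb1 : ‖b‖ ≤ 1) :
    ‖pt g t a - pt g t' b‖ ≤ K * |t - t'| + 6 * K ^ 3 * t' * ‖a - b‖ := by
  have hK := hg.one_le
  have hga := hg.pos (show 0 < ‖a‖ by linarith)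
  have hgb := hg.pos (show 0 < ‖b‖ by linarith)
  have ia : (g a)⁻¹ ≤ 2 * K := by
    rw [inv_le_comm₀ hga (by positivity), inv_le_iff_one_le_mul₀ (by positivity)]
    nlinarith [hg.norm_le a]
  have ib : (g b)⁻¹ ≤ 2 * K := by
    rw [inv_le_comm₀ hgb (by positivity), inv_le_iff_one_le_mul₀ (by positivity)]
    nlinarith [hg.norm_le b]
  have e : pt g t a - pt g t' b = (t - t') • ((g a)⁻¹ • a) + t' • ((g a)⁻¹ • (a - b)) +
      t' • (((g b - g a) * ((g a)⁻¹ * (g b)⁻¹)) • b) := by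
    have : (g b - g a) * ((g a)⁻¹ * (g b)⁻¹) = (g a)⁻¹ - (g b)⁻¹ := by field_simp
    rw [this, pt, pt, div_eq_mul_inv, div_eq_mul_inv]
    module
  have n1 : ‖(t - t') • ((g a)⁻¹ • a)‖ ≤ K * |t - t'| := by
    rw [norm_smul, norm_smul, Real.norm_eq_abs, Real.norm_eq_abs, abs_of_pos (inv_pos.2 hga),
      mul_comm]
    gcongr
    rw [inv_mul_le_iff₀ hga, mul_comm]
    exact hg.norm_le a
  have n2 : ‖t' • ((g a)⁻¹ • (a - b))‖ ≤ t' * (2 * K * ‖a - b‖) := by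
    rw [norm_smul, norm_smul, Real.norm_eq_abs, Real.norm_eq_abs, abs_of_pos (inv_pos.2 hga),
      abs_of_nonneg ht']
    gcongr
  have n3 : ‖t' • (((g b - g a) * ((g a)⁻¹ * (g b)⁻¹)) • b)‖ ≤
      t' * (K * ‖a - b‖ * (2 * K * (2 * K)) * 1) := by
    rw [norm_smul, norm_smul, Real.norm_eq_abs, Real.norm_eq_abs, abs_of_nonneg ht', abs_mul,
      abs_of_pos (mul_pos (inv_pos.2 hga) (inv_pos.2 hgb))]
    have := hg.abs_sub_le b a
    rw [norm_sub_rev] at this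
    gcongr
  rw [e]
  refine (norm_add₃_le.trans (add_le_add (add_le_add n1 n2) n3)).trans ?_
  have h3 : K ≤ K ^ 3 := le_self_pow₀ hK (by norm_num)
  have h4 : 0 ≤ t' * ‖a - b‖ := by positivity
  nlinarith [mul_nonneg h4 (sub_nonneg.2 h3)]

end Quality

/-! ### The initial front: an octahedron around the origin. -/

section Seed

open scoped Classical

/-- The sign `±1` encoded by a Boolean. -/
def sgn (b : Bool) : ℝ := if b then 1 else -1

lemma sgn_mul_self (b : Bool) : sgn b * sgn b = 1 := by cases b <;> simp [sgn]

lemma sgn_eq (b : Bool) : sgn b = 1 ∨ sgn b = -1 := by cases b <;> simp [sgn]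

/-- The six vertices of an octahedron with half axes `c`. -/
noncomputable def octVertex (c : Fin 3 → Bool → ℝ) (i : Fin 3) (b : Bool) : R3 :=
  EuclideanSpace.single i (sgn b * c i b)

/-- The face of the octahedron in the octant with signs `s`. -/
noncomputable def octFace (c : Fin 3 → Bool → ℝ) (s : Fin 3 → Bool) : Finset R3 :=
  Finset.univ.image fun i => octVertex c i (s i)

/-- The faces of the octahedron. -/
noncomputable def octFront (c : Fin 3 → Bool → ℝ) : Finset (Finset R3) :=
  Finset.univ.image (octFace c)

/-- The tetrahedra spanned by the faces of the octahedron and the origin. -/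
noncomputable def octTets (c : Fin 3 → Bool → ℝ) : Finset (Finset R3) :=
  Finset.univ.image fun s => insert 0 (octFace c s)

variable {c : Fin 3 → Bool → ℝ}

lemma octVertex_apply (i j : Fin 3) (b : Bool) :
    octVertex c i b j = if j = i then sgn b * c i b else 0 := by
  simp [octVertex]

lemma octVertex_ne_zero (hc : ∀ i b, 0 < c i b) (i : Fin 3) (b : Bool) : octVertex c i b ≠ 0 := by
  intro h
  have := congrArg (fun v : R3 => v i) h
  simp only [octVertex_apply, if_true, PiLp.zero_apply, mul_eq_zero, (hc i b).ne', or_false] at this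
  rcases sgn_eq b with h | h <;> rw [h] at this <;> norm_num at this

lemma octVertex_inj (hc : ∀ i b, 0 < c i b) {i j : Fin 3} {b b' : Bool}
    (h : octVertex c i b = octVertex c j b') : i = j ∧ b = b' := by
  have h1 := congrArg (fun v : R3 => v i) h
  have hpos := hc i b
  have hpos' := hc j b'
  simp only [octVertex_apply, if_true] at h1
  by_cases hij : i = j
  · subst hij
    refine ⟨rfl, ?_⟩
    rw [if_pos rfl] at h1
    cases b <;> cases b' <;> simp [sgn] at h1 ⊢ <;> linarith
  · rw [if_neg hij] at h1
    rcases sgn_eq b with h | h <;> rw [h] at h1 <;> linarith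

lemma octFace_injective (hc : ∀ i b, 0 < c i b) (s : Fin 3 → Bool) :
    Function.Injective fun i => octVertex c i (s i) := fun _ _ h => (octVertex_inj hc h).1

lemma zero_notMem_octFace (hc : ∀ i b, 0 < c i b) (s : Fin 3 → Bool) : (0 : R3) ∉ octFace c s := by
  intro h
  obtain ⟨i, -, hi⟩ := Finset.mem_image.1 h
  exact octVertex_ne_zero hc i (s i) hi

/-- The weights are the positive and negative parts of the coordinates, rescaled. This formula does
not mention the face, which is why the eight octants fit together into a fan. -/
lemma octFace_weight (hc : ∀ i b, 0 < c i b) {s : Fin 3 → Bool} {w : R3 →₀ ℝ}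
    (hw : WeightsOn (octFace c s) w) (j : Fin 3) (b : Bool) :
    w (octVertex c j b) = max 0 (sgn b * bary w j) / c j b := by
  have hb : bary w j = w (octVertex c j (s j)) * (sgn (s j) * c j (s j)) := by
    rw [bary_eq_sum hw.2, octFace, Finset.sum_image fun i _ k _ h => octFace_injective hc s h]
    simp only [smul_eq_mul, WithLp.ofLp_sum, Finset.sum_apply, octVertex_apply,
      WithLp.ofLp_smul, Pi.smul_apply]
    simp
  have h0 := hw.1 (octVertex c j (s j))
  have hcj := hc j (s j)
  by_cases h : b = s j
  · subst h
    have : sgn (s j) * bary w j = w (octVertex c j (s j)) * c j (s j) := by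
      rw [hb]
      linear_combination w (octVertex c j (s j)) * c j (s j) * sgn_mul_self (s j)
    rw [this, max_eq_right (by positivity), mul_div_cancel_right₀ _ hcj.ne']
  · have hn : octVertex c j b ∉ octFace c s := by
      intro hm
      obtain ⟨i, -, hi⟩ := Finset.mem_image.1 hm
      obtain ⟨rfl, rfl⟩ := octVertex_inj hc hi
      exact h rfl
    have hs : sgn b * sgn (s j) = -1 := by
      cases b <;> cases hsj : s j <;> simp_all [sgn]
    have : sgn b * bary w j = -(w (octVertex c j (s j)) * c j (s j)) := by
      rw [hb]
      linear_combination w (octVertex c j (s j)) * c j (s j) * hs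
    rw [hw.2 _ hn, this, max_eq_left (by nlinarith [mul_nonneg h0 hcj.le]), zero_div]

lemma octFront_cone_unique (hc : ∀ i b, 0 < c i b) {s s' : Fin 3 → Bool} {w w' : R3 →₀ ℝ}
    (hw : WeightsOn (octFace c s) w) (hw' : WeightsOn (octFace c s') w')
    (h : bary w = bary w') : w = w' := by
  ext v
  by_cases hv : ∃ j b, v = octVertex c j b
  · obtain ⟨j, b, rfl⟩ := hv
    rw [octFace_weight hc hw, octFace_weight hc hw', h]
  · have hn : ∀ s, v ∉ octFace c s := fun s hm => by
      obtain ⟨i, -, hi⟩ := Finset.mem_image.1 hm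
      exact hv ⟨i, s i, hi.symm⟩
    rw [hw.2 v (hn s), hw'.2 v (hn s')]

lemma octFront_cone_cover (hc : ∀ i b, 0 < c i b) (x : R3) :
    ∃ s, ∃ w, WeightsOn (octFace c s) w ∧ bary w = x := by
  let s : Fin 3 → Bool := fun i => decide (0 ≤ x i)
  have hs : ∀ i, sgn (s i) * x i = |x i| := fun i => by
    by_cases h : 0 ≤ x i
    · simp [s, sgn, h, abs_of_nonneg h]
    · simp [s, sgn, h, abs_of_neg (not_le.1 h)]
  refine ⟨s, ∑ i, Finsupp.single (octVertex c i (s i)) (|x i| / c i (s i)),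
    ⟨fun v => ?_, fun v hv => ?_⟩, ?_⟩
  · rw [Finsupp.finsetSum_apply]
    refine Finset.sum_nonneg fun i _ => ?_
    have := hc i (s i)
    rw [Finsupp.single_apply]
    split_ifs <;> positivity
  · rw [Finsupp.finsetSum_apply]
    refine Finset.sum_eq_zero fun i _ => ?_
    rw [Finsupp.single_apply, if_neg]
    rintro rfl
    exact hv (Finset.mem_image_of_mem _ (Finset.mem_univ i))
  · have hterm : ∀ j, |x j| / c j (s j) * (sgn (s j) * c j (s j)) = x j := fun j => by
      have h1 := (hc j (s j)).ne'
      rw [← hs j]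
      field_simp
      linear_combination x j * sgn_mul_self (s j)
    ext j
    simp only [map_sum, bary_single, WithLp.ofLp_sum, Finset.sum_apply, WithLp.ofLp_smul,
      Pi.smul_apply, smul_eq_mul, octVertex_apply]
    simp [hterm]

theorem isFront_oct (hc : ∀ i b, 0 < c i b) : IsFront (octFront c) (octTets c) := by
  -- Substituting the zero weights for the vertex `0` forgets the weight at the origin and reduces
  -- tetrahedra to cones over faces.
  have herase : ∀ s u, WeightsOn (insert 0 (octFace c s)) u →
      WeightsOn (octFace c s) (substWeights 0 0 u) ∧ bary (substWeights 0 0 u) = bary u ∧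
      mass (substWeights 0 0 u) = mass u - u 0 := fun s u hu =>
    ⟨hu.substWeights (fun _ => le_rfl) (by simp) (zero_notMem_octFace hc s),
      bary_substWeights (by simp) u, by rw [mass_substWeights]; simp; ring⟩
  refine ⟨?_, ?_, ?_, ?_, ?_, ?_, ?_, ?_⟩
  · simp only [octFront, Finset.mem_image, Finset.mem_univ, true_and]
    rintro _ ⟨s, rfl⟩ _ ⟨s', rfl⟩ w w' hw hw' h
    exact octFront_cone_unique hc hw hw' h
  · intro x
    obtain ⟨s, hs⟩ := octFront_cone_cover hc x
    exact ⟨_, Finset.mem_image_of_mem _ (Finset.mem_univ s), hs⟩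
  · simp only [octTets, Finset.mem_image, Finset.mem_univ, true_and]
    rintro _ ⟨s, rfl⟩ _ ⟨s', rfl⟩ u u' hu hu' hm hm' h
    obtain ⟨a1, a2, a3⟩ := herase s u hu
    obtain ⟨b1, b2, b3⟩ := herase s' u' hu'
    have heq := octFront_cone_unique hc a1 b1 (by rw [a2, b2, h])
    refine eq_of_substWeights_eq heq ?_
    rw [heq, b3] at a3
    linarith
  · simp only [octFront, Finset.mem_image, Finset.mem_univ, true_and]
    rintro _ ⟨s, rfl⟩ w hw
    rw [mem_hullUnion]
    constructor
    · simp only [octTets, Finset.mem_image, Finset.mem_univ, true_and]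
      rintro ⟨_, ⟨s', rfl⟩, u, hu, hm, h⟩
      obtain ⟨a1, a2, a3⟩ := herase s' u hu
      rw [octFront_cone_unique hc hw a1 (by rw [a2, h]), a3, hm]
      linarith [hu.1 0]
    · intro h
      refine ⟨_, Finset.mem_image_of_mem _ (Finset.mem_univ s), w + Finsupp.single 0 (1 - mass w),
        ⟨fun v => ?_, fun v hv => ?_⟩, by simp, by simp⟩
      · rw [Finsupp.add_apply, Finsupp.single_apply]
        have := hw.1 v
        split_ifs <;> linarith
      · simp only [Finset.mem_insert, not_or] at hv
        simp [hw.2 v hv.2, Ne.symm hv.1]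
  · simp only [octFront, Finset.mem_image, Finset.mem_univ, true_and]
    rintro _ ⟨s, rfl⟩
    exact ⟨_, Finset.mem_image_of_mem _ (Finset.mem_univ s), Finset.subset_insert _ _⟩
  · simp only [octTets, Finset.mem_image, Finset.mem_univ, true_and]
    rintro _ ⟨s, rfl⟩ z hz
    have hs : octFace c s ∈ octFront c := Finset.mem_image_of_mem _ (Finset.mem_univ s)
    rcases Finset.mem_insert.1 hz with rfl | hz
    · exact Or.inr ⟨_, hs, 0, ⟨fun _ => le_rfl, fun _ _ => rfl⟩, by simp, by simp⟩
    · exact Or.inl ⟨_, hs, hz⟩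
  · simp only [octFront, Finset.mem_image, Finset.mem_univ, true_and]
    rintro _ ⟨s, rfl⟩
    simp [octFace, Finset.card_image_of_injective _ (octFace_injective hc s)]
  · simp only [octTets, Finset.mem_image, Finset.mem_univ, true_and]
    rintro _ ⟨s, rfl⟩
    rw [Finset.card_insert_of_notMem (zero_notMem_octFace hc s)]
    simp [octFace, Finset.card_image_of_injective _ (octFace_injective hc s)]

end Seed

/-! ### Directions: repeated bisection of the octahedron, whose faces project to isosceles right
triangles. -/

section Directions

/-- `v` lies on the face of the standard octahedron in the octant with signs `s`. -/
def InOct (s : Fin 3 → ℝ) (v : R3) : Prop :=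
  (∀ i, 0 ≤ s i * v i) ∧ s 0 * v 0 + s 1 * v 1 + s 2 * v 2 = 1

/-- The square of the length of the projection to the plane of the first two coordinates. -/
def projSq (v : R3) : ℝ := v 0 ^ 2 + v 1 ^ 2

lemma projSq_sub_comm (a b : R3) : projSq (a - b) = projSq (b - a) := by
  simp only [projSq, PiLp.sub_apply]; ring

lemma norm_sq_eq_three (v : R3) : ‖v‖ ^ 2 = v 0 ^ 2 + v 1 ^ 2 + v 2 ^ 2 := by
  rw [EuclideanSpace.norm_sq_eq, Fin.sum_univ_three]
  simp

/-- The `ℓ¹`-norm. -/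
def normOne (v : R3) : ℝ := |v 0| + |v 1| + |v 2|

lemma InOct.normOne {s : Fin 3 → ℝ} {v : R3} (hs : ∀ i, s i = 1 ∨ s i = -1) (h : InOct s v) :
    normOne v = 1 := by
  have : ∀ i, |v i| = s i * v i := fun i => by
    have h1 := h.1 i
    rcases hs i with h2 | h2 <;> rw [h2] at h1 ⊢
    · rw [one_mul] at h1 ⊢
      exact abs_of_nonneg h1
    · rw [abs_of_nonpos (by linarith)]
      ring
  rw [_root_.normOne, this, this, this, h.2]

lemma norm_le_of_normOne {v : R3} (h : normOne v = 1) : ‖v‖ ≤ 1 := by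
  have h0 := abs_nonneg (v 0)
  have h1 := abs_nonneg (v 1)
  have h2 := abs_nonneg (v 2)
  have := norm_sq_eq_three v
  rw [← sq_abs (v 0), ← sq_abs (v 1), ← sq_abs (v 2)] at this
  rw [normOne] at h
  refine le_of_sq_le_sq ?_ zero_le_one
  rw [this, one_pow, show |v 2| = 1 - |v 0| - |v 1| by linarith]
  nlinarith [mul_nonneg h0 h1, mul_nonneg h0 h2, mul_nonneg h1 h2]

lemma half_le_norm_of_normOne {v : R3} (h : normOne v = 1) : 1 / 2 ≤ ‖v‖ := by
  have := norm_sq_eq_three v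
  rw [← sq_abs (v 0), ← sq_abs (v 1), ← sq_abs (v 2)] at this
  rw [normOne] at h
  by_contra hlt
  push Not at hlt
  have hn := norm_nonneg v
  nlinarith [sq_nonneg (|v 0| - |v 1|), sq_nonneg (|v 0| - |v 2|), sq_nonneg (|v 1| - |v 2|)]

/-- A fourth root of `1 / 2`; each bisection reduces the angular mesh size by the factor `rho ^ 2`. -/
noncomputable def rho : ℝ := √√(1 / 2)

lemma rho_pos : 0 < rho := by unfold rho; positivity

lemma rho_sq_sq : (rho ^ 2) ^ 2 = 1 / 2 := by
  rw [rho, Real.sq_sqrt (by positivity), Real.sq_sqrt (by positivity)]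

lemma rho_lt_one : rho < 1 := by
  by_contra h
  have h1 : 1 ≤ rho ^ 2 := one_le_pow₀ (not_lt.1 h)
  have := rho_sq_sq
  nlinarith

/-- The angular mesh size after `ℓ` bisections. -/
noncomputable def angle (ℓ : ℕ) : ℝ := (rho ^ 2) ^ ℓ

lemma angle_pos (ℓ : ℕ) : 0 < angle ℓ := pow_pos (pow_pos rho_pos 2) ℓ

lemma angle_le_one (ℓ : ℕ) : angle ℓ ≤ 1 :=
  pow_le_one₀ (sq_nonneg _) (pow_le_one₀ rho_pos.le rho_lt_one.le)

lemma angle_sq (ℓ : ℕ) : angle ℓ ^ 2 = (1 / 2) ^ ℓ := by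
  rw [angle, ← pow_mul, mul_comm, pow_mul, rho_sq_sq]

/-- The directions of a triangle after `ℓ` bisections, with hypotenuse `a b`. -/
structure IsDirTriangle (ℓ : ℕ) (a b c : R3) : Prop where
  octant : ∃ s : Fin 3 → ℝ, (∀ i, s i = 1 ∨ s i = -1) ∧ InOct s a ∧ InOct s b ∧ InOct s c
  hyp : projSq (a - b) = 2 * (1 / 2) ^ ℓ
  leg₁ : projSq (a - c) = (1 / 2) ^ ℓ
  leg₂ : projSq (b - c) = (1 / 2) ^ ℓ
  det : |det3 a b c| = (1 / 2) ^ ℓ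

/-- Both points lie in the plane of one octahedron face, where the difference of the third
coordinates is, up to sign, the signed sum of the first two differences. The projection thus
controls the full distance. -/
lemma norm_sub_le_of_inOct {ℓ : ℕ} {s : Fin 3 → ℝ} (hs : ∀ i, s i = 1 ∨ s i = -1) {a b : R3}
    (ha : InOct s a) (hb : InOct s b) (h : projSq (a - b) ≤ 2 * (1 / 2) ^ ℓ) :
    ‖a - b‖ ≤ 3 * angle ℓ := by
  have hsq : ∀ i, s i ^ 2 = 1 := fun i => by rcases hs i with h | h <;> rw [h] <;> norm_num
  refine le_of_sq_le_sq ?_ (by have := angle_pos ℓ; positivity)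
  have h1 := norm_sq_eq_three (a - b)
  rw [projSq] at h
  have h2 := ha.2
  have h3 := hb.2
  rw [mul_pow, angle_sq, h1]
  simp only [PiLp.sub_apply] at h ⊢
  have h4 : (a 2 - b 2) ^ 2 = (s 0 * (a 0 - b 0) + s 1 * (a 1 - b 1)) ^ 2 := by
    have : s 0 * (a 0 - b 0) + s 1 * (a 1 - b 1) = -(s 2 * (a 2 - b 2)) := by linarith
    rw [this, neg_sq, mul_pow, hsq, one_mul]
  have h5 : (s 0 * (a 0 - b 0) + s 1 * (a 1 - b 1)) ^ 2 ≤
      2 * ((a 0 - b 0) ^ 2 + (a 1 - b 1) ^ 2) := by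
    have e0 : (s 0 * (a 0 - b 0)) ^ 2 = (a 0 - b 0) ^ 2 := by rw [mul_pow, hsq, one_mul]
    have e1 : (s 1 * (a 1 - b 1)) ^ 2 = (a 1 - b 1) ^ 2 := by rw [mul_pow, hsq, one_mul]
    nlinarith [sq_nonneg (s 0 * (a 0 - b 0) - s 1 * (a 1 - b 1))]
  have h6 : (0 : ℝ) ≤ (1 / 2) ^ ℓ := by positivity
  nlinarith

lemma InOct.midpoint {s : Fin 3 → ℝ} {a b : R3} (ha : InOct s a) (hb : InOct s b) :
    InOct s ((1 / 2 : ℝ) • (a + b)) := by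
  refine ⟨fun i => ?_, ?_⟩
  · have := ha.1 i
    have := hb.1 i
    simp only [PiLp.smul_apply, PiLp.add_apply, smul_eq_mul]
    linarith
  · have := ha.2
    have := hb.2
    simp only [PiLp.smul_apply, PiLp.add_apply, smul_eq_mul]
    linarith

namespace IsDirTriangle

variable {ℓ : ℕ} {a b c : R3}

lemma swap (h : IsDirTriangle ℓ a b c) : IsDirTriangle ℓ b a c := by
  obtain ⟨s, hs, ha, hb, hc⟩ := h.octant
  refine ⟨⟨s, hs, hb, ha, hc⟩, by rw [projSq_sub_comm, h.hyp], h.leg₂, h.leg₁, ?_⟩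
  rw [← h.det, ← abs_neg]
  congr 1
  simp only [det3]; ring

/-- One of the halves of a triangle. -/
lemma bisect (h : IsDirTriangle ℓ a b c) :
    IsDirTriangle (ℓ + 1) b c ((1 / 2 : ℝ) • (a + b)) := by
  obtain ⟨s, hs, ha, hb, hc⟩ := h.octant
  have h1 := h.hyp
  have h2 := h.leg₁
  have h3 := h.leg₂
  simp only [projSq, PiLp.sub_apply] at h1 h2 h3
  refine ⟨⟨s, hs, hb, hc, ha.midpoint hb⟩, ?_, ?_, ?_, ?_⟩
  · rw [h.leg₂, pow_succ]; ring
  · simp only [projSq, PiLp.sub_apply, PiLp.smul_apply, PiLp.add_apply, smul_eq_mul]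
    rw [pow_succ]
    linear_combination h1 / 4
  · simp only [projSq, PiLp.sub_apply, PiLp.smul_apply, PiLp.add_apply, smul_eq_mul]
    rw [pow_succ]
    linear_combination h2 / 2 + h3 / 2 - h1 / 4
  · have : det3 b c ((1 / 2 : ℝ) • (a + b)) = 1 / 2 * det3 a b c := by
      simp only [det3, PiLp.smul_apply, PiLp.add_apply, smul_eq_mul]
      ring
    rw [this, abs_mul, h.det, pow_succ, abs_of_pos (by norm_num)]
    ring

lemma normOne_eq (h : IsDirTriangle ℓ a b c) : normOne a = 1 ∧ normOne b = 1 ∧ normOne c = 1 := by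
  obtain ⟨s, hs, ha, hb, hc⟩ := h.octant
  exact ⟨ha.normOne hs, hb.normOne hs, hc.normOne hs⟩

lemma ne (h : IsDirTriangle ℓ a b c) : a ≠ b ∧ a ≠ c ∧ b ≠ c := by
  have hp : (0 : ℝ) < (1 / 2) ^ ℓ := by positivity
  have h0 : projSq 0 = 0 := by simp [projSq]
  refine ⟨?_, ?_, ?_⟩ <;> rintro rfl
  · have := h.hyp
    rw [sub_self, h0] at this
    linarith
  · have := h.leg₁
    rw [sub_self, h0] at this
    linarith
  · have := h.leg₂
    rw [sub_self, h0] at this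
    linarith

lemma norm_sub_le (h : IsDirTriangle ℓ a b c) :
    ‖a - b‖ ≤ 3 * angle ℓ ∧ ‖a - c‖ ≤ 3 * angle ℓ ∧ ‖b - c‖ ≤ 3 * angle ℓ := by
  obtain ⟨s, hs, ha, hb, hc⟩ := h.octant
  have hp : (0 : ℝ) < (1 / 2) ^ ℓ := by positivity
  exact ⟨norm_sub_le_of_inOct hs ha hb h.hyp.le, norm_sub_le_of_inOct hs ha hc (by
    rw [h.leg₁]; linarith), norm_sub_le_of_inOct hs hb hc (by rw [h.leg₂]; linarith)⟩

end IsDirTriangle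

lemma normOne_smul {t : ℝ} (ht : 0 ≤ t) (v : R3) : normOne (t • v) = t * normOne v := by
  simp only [normOne, PiLp.smul_apply, smul_eq_mul, abs_mul, abs_of_nonneg ht]
  ring

/-- The `ℓ¹`-norm of the point recovers the scaling factor, since both directions are normalised. -/
lemma pt_inj {g : R3 → ℝ} {K : ℝ} (hg : IsGauge g K) {t t' : ℝ} (ht : 0 < t) (ht' : 0 < t')
    {a b : R3} (ha : normOne a = 1) (hb : normOne b = 1) (h : pt g t a = pt g t' b) : a = b := by
  have hga := hg.pos (lt_of_lt_of_le (by norm_num) (half_le_norm_of_normOne ha))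
  have hgb := hg.pos (lt_of_lt_of_le (by norm_num) (half_le_norm_of_normOne hb))
  have hta : 0 < t / g a := by positivity
  have htb : 0 < t' / g b := by positivity
  have h1 := congrArg normOne h
  rw [pt, pt, normOne_smul hta.le, normOne_smul htb.le, ha, hb, mul_one, mul_one] at h1
  rw [pt, pt, ← h1] at h
  exact smul_right_injective R3 hta.ne' h

section

open scoped Classical

/-- A triangle whose directions are obtained by `ℓ` bisections, with heights in `{T, T'}`. -/
def IsFrontTriangle (g : R3 → ℝ) (ℓ : ℕ) (T T' : ℝ) (σ : Finset R3) : Prop :=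
  ∃ a b c ta tb tc, IsDirTriangle ℓ a b c ∧ (ta = T ∨ ta = T') ∧ (tb = T ∨ tb = T') ∧
    (tc = T ∨ tc = T') ∧ σ = {pt g ta a, pt g tb b, pt g tc c}

/-- The constant of shape regularity. -/
noncomputable def regConst (K η : ℝ) : ℝ := 72 / (η / (37 ^ 3 * K ^ 12))

/-- All edges are at most a multiple of `angle ℓ * T`. The determinant is the mass excess, at least
`η * angle ℓ`, times the cone determinant over the old triangle, at least `(T / K) ^ 3 * angle ℓ ^
2`. Together these are comparable to the cube of the edge bound, with a ratio independent of `ℓ` and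
`T`. -/
lemma isGoodSimplex_insert {g : R3 → ℝ} {K η : ℝ} (hg : IsGauge g K) (hη : 0 < η) {ℓ : ℕ}
    {T T' : ℝ} (hT : 0 < T) (h1 : η * (angle ℓ * T) ≤ T' - T) (h2 : T' - T ≤ angle ℓ * T)
    {a b c d : R3} {ta tb tc α β γ : ℝ} (h : IsDirTriangle ℓ a b c) (ha : ta = T ∨ ta = T')
    (hb : tb = T ∨ tb = T') (hc : tc = T ∨ tc = T') (hd : normOne d = 1)
    (hda : ‖a - d‖ ≤ 3 * angle ℓ) (hdb : ‖b - d‖ ≤ 3 * angle ℓ) (hdc : ‖c - d‖ ≤ 3 * angle ℓ)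
    (hp : pt g T' d = α • pt g ta a + β • pt g tb b + γ • pt g tc c) (hm : T' / T ≤ α + β + γ) :
    IsGoodSimplex (regConst K η) (37 * K ^ 3 * (angle ℓ * T))
      {pt g T' d, pt g ta a, pt g tb b, pt g tc c} := by
  have hK := hg.one_le
  have hε := angle_pos ℓ
  have hε1 := angle_le_one ℓ
  have hεT : 0 < angle ℓ * T := by positivity
  have hTT : T ≤ T' := by nlinarith [mul_pos hη hεT]
  have hT2 : T' ≤ 2 * T := by nlinarith
  have hK3 : K ≤ K ^ 3 := le_self_pow₀ hK (by norm_num)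
  have bnd : ∀ t : ℝ, t = T ∨ t = T' → T ≤ t ∧ t ≤ T' := by
    rintro t (rfl | rfl)
    exacts [⟨le_rfl, hTT⟩, ⟨hTT, le_rfl⟩]
  have dist : ∀ t t' : ℝ, t = T ∨ t = T' → t' = T ∨ t' = T' → ∀ x y, normOne x = 1 →
      normOne y = 1 → ‖x - y‖ ≤ 3 * angle ℓ →
      ‖pt g t x - pt g t' y‖ ≤ 37 * K ^ 3 * (angle ℓ * T) := by
    intro t t' ht ht' x y hx hy hxy
    obtain ⟨a1, a2⟩ := bnd t ht
    obtain ⟨b1, b2⟩ := bnd t' ht'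
    refine (hg.norm_pt_sub_le (by linarith) (half_le_norm_of_normOne hx)
      (half_le_norm_of_normOne hy) (norm_le_of_normOne hy)).trans ?_
    have e1 : |t - t'| ≤ angle ℓ * T := by rw [abs_le]; constructor <;> linarith
    -- The `37` is `1` from the change of height plus `36 = 6 * 2 * 3` from the change of direction,
    -- using `t' ≤ 2 * T`.
    calc K * |t - t'| + 6 * K ^ 3 * t' * ‖x - y‖
        ≤ K ^ 3 * (angle ℓ * T) + 6 * K ^ 3 * (2 * T) * (3 * angle ℓ) := by
          gcongr
          linarith
      _ = _ := by ring
  obtain ⟨na, nb, nc⟩ := h.normOne_eq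
  obtain ⟨dab, dac, dbc⟩ := h.norm_sub_le
  refine isGoodSimplex_of_det (by positivity) (by positivity)
    (dist _ _ ha (Or.inr rfl) _ _ na hd hda) (dist _ _ hb (Or.inr rfl) _ _ nb hd hdb)
    (dist _ _ hc (Or.inr rfl) _ _ nc hd hdc) (dist _ _ ha hb _ _ na nb dab)
    (dist _ _ ha hc _ _ na nc dac) (dist _ _ hb hc _ _ nb nc dbc) ?_
  rw [hp, det3_sub_combination, pt, pt, pt, det3_smul, abs_mul, abs_mul, h.det, ← angle_sq]
  have coef : ∀ t : ℝ, t = T ∨ t = T' → ∀ x, normOne x = 1 → T / K ≤ t / g x := by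
    intro t ht x hx
    have hgx := hg.pos (lt_of_lt_of_le (by norm_num) (half_le_norm_of_normOne hx))
    have hgK : g x ≤ K := (hg.le_norm x).trans (by nlinarith [norm_le_of_normOne hx])
    have := (bnd t ht).1
    have ht0 : 0 ≤ t := hT.le.trans this
    gcongr
  have cf : (T / K) ^ 3 ≤ |ta / g a * (tb / g b) * (tc / g c)| := by
    refine le_trans ?_ (le_abs_self _)
    calc (T / K) ^ 3 = T / K * (T / K) * (T / K) := by ring
      _ ≤ _ := by
        have hTK : 0 < T / K := by positivity
        have h1 := coef ta ha a na
        have h2 := coef tb hb b nb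
        have h3 := coef tc hc c nc
        have h12 := mul_le_mul h1 h2 hTK.le (hTK.le.trans h1)
        exact mul_le_mul h12 h3 hTK.le ((mul_nonneg hTK.le hTK.le).trans h12)
  have sm : η * angle ℓ ≤ |1 - (α + β + γ)| := by
    rw [abs_sub_comm]
    refine le_trans ?_ (le_abs_self _)
    have : 1 + η * angle ℓ ≤ T' / T := by
      rw [le_div_iff₀ hT]
      linarith
    linarith
  calc η / (37 ^ 3 * K ^ 12) * (37 * K ^ 3 * (angle ℓ * T)) ^ 3
      = η * angle ℓ * ((T / K) ^ 3 * angle ℓ ^ 2) := by field_simp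
    _ ≤ _ := by gcongr

end

end Directions

/-! ### Growing the mesh: raising vertices and bisecting triangles. -/

section Growth

open scoped Classical

/-- A front together with bounds for its tetrahedra: shape regularity, an upper bound for the
diameters, and a lower bound for the largest diameter. -/
structure IsMesh (κ D δ : ℝ) (𝒯 𝒦 : Finset (Finset R3)) : Prop where
  front : IsFront 𝒯 𝒦
  good : ∀ s ∈ 𝒦, IsGoodSimplex κ D s
  big : ∃ s ∈ 𝒦, δ ≤ Metric.diam (convexHull ℝ (s : Set R3))

lemma IsMesh.star {κ D δ : ℝ} {𝒯 𝒦 : Finset (Finset R3)} (H : IsMesh κ D δ 𝒯 𝒦) {μ : R3 →₀ ℝ}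
    {p : R3} (hμ : ∀ v, 0 ≤ μ v) (hm : 1 < mass μ) (hp : bary μ = p)
    (hσ : ∃ σ ∈ 𝒯, μ.support ⊆ σ)
    (hgood : ∀ σ ∈ 𝒯, μ.support ⊆ σ → IsGoodSimplex κ D (insert p σ)) :
    IsMesh κ D δ (starFront 𝒯 μ.support p) (starTets 𝒯 𝒦 μ.support p) := by
  refine ⟨H.front.star hμ hm hp hσ, fun s hs => ?_, ?_⟩
  · rcases mem_starTets.1 hs with h | ⟨σ, h1, h2, rfl⟩
    exacts [H.good s h, hgood σ h1 h2]
  · obtain ⟨s, hs, h⟩ := H.big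
    exact ⟨s, mem_starTets.2 (Or.inl hs), h⟩

/-- The heights `T < T'` are consecutive: `T' - T` is comparable to the mesh size at height `T`
after `ℓ` bisections. -/
structure IsStep (η : ℝ) (ℓ : ℕ) (T T' : ℝ) : Prop where
  pos : 0 < T
  le : η * (angle ℓ * T) ≤ T' - T
  ge : T' - T ≤ angle ℓ * T

lemma IsStep.lt {η : ℝ} (hη : 0 < η) {ℓ : ℕ} {T T' : ℝ} (h : IsStep η ℓ T T') : T < T' := by
  have := h.le
  have := mul_pos hη (mul_pos (angle_pos ℓ) h.pos)
  linarith

lemma IsDirTriangle.pt_ne {g : R3 → ℝ} {K : ℝ} (hg : IsGauge g K) {ℓ : ℕ} {a b c : R3}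
    (h : IsDirTriangle ℓ a b c) {ta tb tc : ℝ} (ha : 0 < ta) (hb : 0 < tb) (hc : 0 < tc) :
    pt g ta a ≠ pt g tb b ∧ pt g ta a ≠ pt g tc c ∧ pt g tb b ≠ pt g tc c := by
  obtain ⟨na, nb, nc⟩ := h.normOne_eq
  obtain ⟨h1, h2, h3⟩ := h.ne
  exact ⟨fun h => h1 (pt_inj hg ha hb na nb h), fun h => h2 (pt_inj hg ha hc na nc h),
    fun h => h3 (pt_inj hg hb hc nb nc h)⟩

lemma IsGauge.apply_pt_of_normOne {g : R3 → ℝ} {K : ℝ} (hg : IsGauge g K) {t : ℝ} (ht : 0 ≤ t)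
    {v : R3} (hv : normOne v = 1) : g (pt g t v) = t :=
  hg.apply_pt ht (lt_of_lt_of_le (by norm_num) (half_le_norm_of_normOne hv))

lemma smul_pt {g : R3 → ℝ} {T : ℝ} (hT : T ≠ 0) (T' : ℝ) (v : R3) :
    (T' / T) • pt g T v = pt g T' v := by
  rw [pt, pt, smul_smul]
  congr 1
  field_simp

section

variable {g : R3 → ℝ} {K η : ℝ} {ℓ : ℕ} {T T' : ℝ}

/-- Raising a vertex of a triangle from height `T` to height `T'`. -/
lemma IsFrontTriangle.raise (hg : IsGauge g K) (hη : 0 < η) (hstep : IsStep η ℓ T T')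
    {σ : Finset R3} (hσ : IsFrontTriangle g ℓ T T' σ) {P : R3} (hP : P ∈ σ) (hgP : g P = T) :
    IsGoodSimplex (regConst K η) (37 * K ^ 3 * (angle ℓ * T)) (insert ((T' / T) • P) σ) ∧
      IsFrontTriangle g ℓ T T' (insert ((T' / T) • P) (σ.erase P)) := by
  obtain ⟨a, b, c, ta, tb, tc, h, ha, hb, hc, rfl⟩ := hσ
  have hT := hstep.pos
  have hlt := hstep.lt hη
  have pos : ∀ t : ℝ, t = T ∨ t = T' → 0 < t := by
    rintro t (rfl | rfl) <;> linarith
  obtain ⟨na, nb, nc⟩ := h.normOne_eq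
  obtain ⟨dab, dac, dbc⟩ := h.norm_sub_le
  obtain ⟨e1, e2, e3⟩ := h.pt_ne hg (pos _ ha) (pos _ hb) (pos _ hc)
  have hε : 0 ≤ 3 * angle ℓ := by have := angle_pos ℓ; positivity
  simp only [Finset.mem_insert, Finset.mem_singleton] at hP
  rcases hP with rfl | rfl | rfl
  · rw [hg.apply_pt_of_normOne (pos _ ha).le na] at hgP
    subst hgP
    rw [smul_pt hT.ne']
    refine ⟨isGoodSimplex_insert hg hη hT hstep.le hstep.ge h ha hb hc na (by simpa using hε)
      (by rwa [norm_sub_rev]) (by rwa [norm_sub_rev]) (α := T' / ta) (β := 0) (γ := 0)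
      (by rw [smul_pt hT.ne']; simp) (by simp), a, b, c, T', tb, tc, h, Or.inr rfl, hb, hc, ?_⟩
    congr 1
    ext x
    simp only [Finset.mem_erase, Finset.mem_insert, Finset.mem_singleton]
    grind
  · rw [hg.apply_pt_of_normOne (pos _ hb).le nb] at hgP
    subst hgP
    rw [smul_pt hT.ne']
    refine ⟨isGoodSimplex_insert hg hη hT hstep.le hstep.ge h ha hb hc nb dab (by simpa using hε)
      (by rwa [norm_sub_rev]) (α := 0) (β := T' / tb) (γ := 0)
      (by rw [smul_pt hT.ne']; simp) (by simp), a, b, c, ta, T', tc, h, ha, Or.inr rfl, hc, ?_⟩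
    ext x
    simp only [Finset.mem_erase, Finset.mem_insert, Finset.mem_singleton]
    grind
  · rw [hg.apply_pt_of_normOne (pos _ hc).le nc] at hgP
    subst hgP
    rw [smul_pt hT.ne']
    refine ⟨isGoodSimplex_insert hg hη hT hstep.le hstep.ge h ha hb hc nc dac dbc
      (by simpa using hε) (α := 0) (β := 0) (γ := T' / tc)
      (by rw [smul_pt hT.ne']; simp) (by simp), a, b, c, ta, tb, T', h, ha, hb, Or.inr rfl, ?_⟩
    ext x
    simp only [Finset.mem_erase, Finset.mem_insert, Finset.mem_singleton]
    grind

lemma IsFrontTriangle.height (hg : IsGauge g K) (hT : 0 < T) (hT' : 0 < T')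
    {σ : Finset R3} (hσ : IsFrontTriangle g ℓ T T' σ) {P : R3} (hP : P ∈ σ) :
    g P = T ∨ g P = T' := by
  obtain ⟨a, b, c, ta, tb, tc, h, ha, hb, hc, rfl⟩ := hσ
  have pos : ∀ t : ℝ, t = T ∨ t = T' → 0 < t := by
    rintro t (rfl | rfl) <;> assumption
  obtain ⟨na, nb, nc⟩ := h.normOne_eq
  simp only [Finset.mem_insert, Finset.mem_singleton] at hP
  rcases hP with rfl | rfl | rfl
  · rwa [hg.apply_pt_of_normOne (pos _ ha).le na]
  · rwa [hg.apply_pt_of_normOne (pos _ hb).le nb]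
  · rwa [hg.apply_pt_of_normOne (pos _ hc).le nc]

lemma IsFrontTriangle.of_height (hg : IsGauge g K) (hT : 0 < T) (hT' : 0 < T')
    {σ : Finset R3} (hσ : IsFrontTriangle g ℓ T T' σ) (h' : ∀ P ∈ σ, g P ≠ T) :
    IsFrontTriangle g ℓ T' T' σ := by
  obtain ⟨a, b, c, ta, tb, tc, h, ha, hb, hc, rfl⟩ := hσ
  have pos : ∀ t : ℝ, t = T ∨ t = T' → 0 < t := by
    rintro t (rfl | rfl) <;> assumption
  obtain ⟨na, nb, nc⟩ := h.normOne_eq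
  have h1 := h' (pt g ta a) (by simp)
  have h2 := h' (pt g tb b) (by simp)
  have h3 := h' (pt g tc c) (by simp)
  rw [hg.apply_pt_of_normOne (pos _ ha).le na] at h1
  rw [hg.apply_pt_of_normOne (pos _ hb).le nb] at h2
  rw [hg.apply_pt_of_normOne (pos _ hc).le nc] at h3
  exact ⟨a, b, c, ta, tb, tc, h, Or.inr (ha.resolve_left h1), Or.inr (hb.resolve_left h2),
    Or.inr (hc.resolve_left h3), rfl⟩

/-- Raising all the vertices of the front to height `T'`. -/
theorem IsMesh.raise (hg : IsGauge g K) (hη : 0 < η) (hstep : IsStep η ℓ T T') {D δ : ℝ}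
    (hD : 37 * K ^ 3 * (angle ℓ * T) ≤ D) {𝒯 𝒦 : Finset (Finset R3)}
    (H : IsMesh (regConst K η) D δ 𝒯 𝒦) (htri : ∀ σ ∈ 𝒯, IsFrontTriangle g ℓ T T' σ) :
    ∃ 𝒯' 𝒦', IsMesh (regConst K η) D δ 𝒯' 𝒦' ∧ ∀ σ ∈ 𝒯', IsFrontTriangle g ℓ T' T' σ := by
  -- Vertices are raised one at a time; the induction counts those still at height `T`.
  induction hn : ((𝒯.biUnion id).filter fun P => g P = T).card using Nat.strong_induction_on
    generalizing 𝒯 𝒦 with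
  | _ n ih =>
  have hT := hstep.pos
  have hlt := hstep.lt hη
  have hT' : 0 < T' := hT.trans hlt
  by_cases hex : ∃ σ ∈ 𝒯, ∃ P ∈ σ, g P = T
  · obtain ⟨σ₀, hσ₀, P, hP, hgP⟩ := hex
    have hq : 0 < T' / T := by positivity
    have hsupp : (Finsupp.single P (T' / T)).support = {P} := Finsupp.support_single P hq.ne'
    have hm : 1 < mass (Finsupp.single P (T' / T)) := by
      rw [mass_single, one_lt_div hT]
      exact hlt
    have hμ : ∀ v, 0 ≤ Finsupp.single P (T' / T) v := fun v => by
      rw [Finsupp.single_apply]; split_ifs <;> positivity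
    have hσ : ∃ σ ∈ 𝒯, (Finsupp.single P (T' / T)).support ⊆ σ :=
      ⟨σ₀, hσ₀, by simpa [hsupp] using hP⟩
    have H' := H.star hμ hm (bary_single _ _) hσ fun σ h1 h2 => by
      rw [hsupp, Finset.singleton_subset_iff] at h2
      exact ((htri σ h1).raise hg hη hstep h2 hgP).1.mono hD
    have hspec := fun σ' h => H.front.starFront_spec hμ hm (bary_single _ _) hσ (σ' := σ') h
    rw [hsupp] at H' hspec
    have hgp : g ((T' / T) • P) = T' := by rw [hg.smul _ hq.le, hgP, div_mul_cancel₀ _ hT.ne']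
    refine ih _ ?_ H' (fun σ' h => ?_) rfl
    · rw [← hn]
      refine Finset.card_lt_card (Finset.ssubset_iff_of_subset (fun Q hQ => ?_) |>.2 ⟨P, ?_, ?_⟩)
      · simp only [Finset.mem_filter, Finset.mem_biUnion, id] at hQ ⊢
        obtain ⟨⟨σ', hσ', hQ'⟩, hgQ⟩ := hQ
        refine ⟨?_, hgQ⟩
        rcases mem_starFront.1 hσ' with ⟨h1, -⟩ | ⟨σ₁, h1, h2, i, hi, rfl⟩
        · exact ⟨σ', h1, hQ'⟩
        · rcases Finset.mem_insert.1 hQ' with rfl | hQ'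
          · rw [hgp] at hgQ
            exact absurd hgQ hlt.ne'
          · exact ⟨σ₁, h1, Finset.mem_of_mem_erase hQ'⟩
      · simp only [Finset.mem_filter, Finset.mem_biUnion, id]
        exact ⟨⟨σ₀, hσ₀, hP⟩, hgP⟩
      · simp only [Finset.mem_filter, Finset.mem_biUnion, id, not_and]
        rintro ⟨σ', hσ', hP'⟩
        obtain ⟨-, i, hi, hi'⟩ := hspec σ' hσ'
        rw [Finset.mem_singleton.1 hi] at hi'
        exact absurd hP' hi'
    · rcases mem_starFront.1 h with ⟨h1, -⟩ | ⟨σ₁, h1, h2, i, hi, rfl⟩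
      · exact htri σ' h1
      · rw [Finset.mem_singleton.1 hi]
        exact ((htri σ₁ h1).raise hg hη hstep (Finset.singleton_subset_iff.1 h2) hgP).2
  · push Not at hex
    exact ⟨𝒯, 𝒦, H, fun σ h => (htri σ h).of_height hg hT hT' (hex σ h)⟩

/-- The triangles that contain a hypotenuse. -/
lemma exists_of_hyp_subset (hg : IsGauge g K) (hT : 0 < T) (hT' : 0 < T') {a b c : R3}
    (h : IsDirTriangle ℓ a b c) {σ : Finset R3}
    (hσ : IsFrontTriangle g ℓ T T σ ∨ IsFrontTriangle g (ℓ + 1) T T' σ)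
    (ha : pt g T a ∈ σ) (hb : pt g T b ∈ σ) :
    ∃ c', IsDirTriangle ℓ a b c' ∧ σ = {pt g T a, pt g T b, pt g T c'} := by
  have pos : ∀ t : ℝ, t = T ∨ t = T' → 0 < t := by
    rintro t (rfl | rfl) <;> assumption
  have hp : (0 : ℝ) < (1 / 2) ^ ℓ := by positivity
  have hp' : ((1 : ℝ) / 2) ^ (ℓ + 1) = (1 / 2) ^ ℓ / 2 := by rw [pow_succ]; ring
  obtain ⟨na, nb, nc⟩ := h.normOne_eq
  have hyp := h.hyp
  have hyp' := h.swap.hyp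
  have ne := h.ne.1
  -- Projected lengths identify the edge. At level `ℓ` only a hypotenuse has squared length `2 * (1
  -- / 2) ^ ℓ`, and at level `ℓ + 1` every edge is shorter. So all triangles sharing the edge have
  -- it as hypotenuse, and bisecting them together stays conforming.
  rcases hσ with ⟨x, y, z, tx, ty, tz, h', hx, hy, hz, rfl⟩ | ⟨x, y, z, tx, ty, tz, h', hx, hy, hz, rfl⟩
  · simp only [or_self] at hx hy hz
    subst hx hy hz
    obtain ⟨nx, ny, nz⟩ := h'.normOne_eq
    simp only [Finset.mem_insert, Finset.mem_singleton] at ha hb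
    have key : ∀ v w, normOne v = 1 → normOne w = 1 → pt g tz v = pt g tz w → v = w :=
      fun v w hv hw => pt_inj hg hT hT hv hw
    have h1 := h'.leg₁
    have h2 := h'.leg₂
    have h1' := h'.leg₁
    have h2' := h'.leg₂
    rw [projSq_sub_comm] at h1' h2'
    rcases ha with ha | ha | ha
    · obtain rfl := key _ _ na nx ha
      rcases hb with hb | hb | hb
      · exact absurd (key _ _ nb nx hb).symm ne
      · obtain rfl := key _ _ nb ny hb
        exact ⟨z, h', rfl⟩
      · obtain rfl := key _ _ nb nz hb
        linarith
    · obtain rfl := key _ _ na ny ha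
      rcases hb with hb | hb | hb
      · obtain rfl := key _ _ nb nx hb
        exact ⟨z, h'.swap, Finset.insert_comm _ _ _⟩
      · exact absurd (key _ _ nb ny hb).symm ne
      · obtain rfl := key _ _ nb nz hb
        linarith
    · obtain rfl := key _ _ na nz ha
      rcases hb with hb | hb | hb
      · obtain rfl := key _ _ nb nx hb
        linarith
      · obtain rfl := key _ _ nb ny hb
        linarith
      · exact absurd (key _ _ nb nz hb).symm ne
  · exfalso
    obtain ⟨nx, ny, nz⟩ := h'.normOne_eq
    simp only [Finset.mem_insert, Finset.mem_singleton] at ha hb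
    have key : ∀ v w t, t = T ∨ t = T' → normOne v = 1 → normOne w = 1 →
        pt g T v = pt g t w → v = w :=
      fun v w t ht hv hw => pt_inj hg hT (pos t ht) hv hw
    have h0 := h'.hyp
    have h1 := h'.leg₁
    have h2 := h'.leg₂
    have h0' := h'.hyp
    have h1' := h'.leg₁
    have h2' := h'.leg₂
    rw [projSq_sub_comm] at h0' h1' h2'
    rcases ha with ha | ha | ha
    · obtain rfl := key _ _ _ hx na nx ha
      rcases hb with hb | hb | hb
      · exact ne (key _ _ _ hx nb nx hb).symm
      · obtain rfl := key _ _ _ hy nb ny hb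
        linarith
      · obtain rfl := key _ _ _ hz nb nz hb
        linarith
    · obtain rfl := key _ _ _ hy na ny ha
      rcases hb with hb | hb | hb
      · obtain rfl := key _ _ _ hx nb nx hb
        linarith
      · exact ne (key _ _ _ hy nb ny hb).symm
      · obtain rfl := key _ _ _ hz nb nz hb
        linarith
    · obtain rfl := key _ _ _ hz na nz ha
      rcases hb with hb | hb | hb
      · obtain rfl := key _ _ _ hx nb nx hb
        linarith
      · obtain rfl := key _ _ _ hy nb ny hb
        linarith
      · exact ne (key _ _ _ hz nb nz hb).symm

/-- The halves of a triangle after its hypotenuse is starred. -/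
lemma IsDirTriangle.isFrontTriangle_bisect (hg : IsGauge g K) (hT : 0 < T) {a b c : R3}
    (h : IsDirTriangle ℓ a b c) :
    IsFrontTriangle g (ℓ + 1) T T' (insert (pt g T' ((1 / 2 : ℝ) • (a + b)))
      (({pt g T a, pt g T b, pt g T c} : Finset R3).erase (pt g T a))) := by
  obtain ⟨e1, e2, e3⟩ := h.pt_ne hg hT hT hT
  refine ⟨_, _, _, T, T, T', h.bisect, Or.inl rfl, Or.inl rfl, Or.inr rfl, ?_⟩
  ext x
  simp only [Finset.mem_erase, Finset.mem_insert, Finset.mem_singleton]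
  grind

/-- Bisecting all the triangles of the front. -/
theorem IsMesh.bisect (hg : IsGauge g K) (hη : 0 < η) (hstep : IsStep η ℓ T T') {D δ : ℝ}
    (hD : 37 * K ^ 3 * (angle ℓ * T) ≤ D) {𝒯 𝒦 : Finset (Finset R3)}
    (H : IsMesh (regConst K η) D δ 𝒯 𝒦)
    (htri : ∀ σ ∈ 𝒯, IsFrontTriangle g ℓ T T σ ∨ IsFrontTriangle g (ℓ + 1) T T' σ) :
    ∃ 𝒯' 𝒦', IsMesh (regConst K η) D δ 𝒯' 𝒦' ∧ ∀ σ ∈ 𝒯', IsFrontTriangle g (ℓ + 1) T T' σ := by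
  -- Each starring removes all triangles sharing one hypotenuse and creates only triangles of level
  -- `ℓ + 1` with a vertex at height `T'`, so the number of unbisected triangles drops.
  induction hn : (𝒯.filter fun σ => IsFrontTriangle g ℓ T T σ).card using Nat.strong_induction_on
    generalizing 𝒯 𝒦 with
  | _ n ih =>
  have hT := hstep.pos
  have hlt := hstep.lt hη
  have hT' : 0 < T' := hT.trans hlt
  by_cases hex : ∃ σ ∈ 𝒯, IsFrontTriangle g ℓ T T σ
  · obtain ⟨σ₀, hσ₀, htσ₀⟩ := hex
    obtain ⟨a, b, c, ta, tb, tc, h, ha, hb, hc, hσe⟩ := id htσ₀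
    simp only [or_self] at ha hb hc
    rw [ha, hb, hc] at hσe
    obtain ⟨na, nb, nc⟩ := h.normOne_eq
    set m : R3 := (1 / 2 : ℝ) • (a + b) with hm
    have nm : normOne m = 1 := h.bisect.normOne_eq.2.2
    have gpos : ∀ v, normOne v = 1 → 0 < g v := fun v hv =>
      hg.pos (lt_of_lt_of_le (by norm_num) (half_le_norm_of_normOne hv))
    have ga := gpos a na
    have gb := gpos b nb
    have gm := gpos m nm
    have hab := (h.pt_ne hg hT hT hT).1
    -- The coefficients that express the point at height `T'` above the midpoint direction through
    -- the two ends of the hypotenuse at height `T`.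
    set α : ℝ := T' * g a / (2 * (T * g m)) with hα
    set β : ℝ := T' * g b / (2 * (T * g m)) with hβ
    have hα0 : 0 < α := by positivity
    have hβ0 : 0 < β := by positivity
    have hcomb : pt g T' m = α • pt g T a + β • pt g T b := by
      rw [pt, pt, pt, hm, smul_smul, smul_smul, smul_smul, ← hm, smul_add]
      congr 2
      · rw [hα]; field_simp
      · rw [hβ]; field_simp
    -- Convexity enters here: `g` at the midpoint is at most the mean of its end values, so the new
    -- vertex is at least as far beyond the edge as for a flat level set.
    have hαβ : T' / T ≤ α + β := by
      have h1 : 2 * g m ≤ g a + g b := by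
        have h2 := hg.add_le a b
        have h3 : g m = 1 / 2 * g (a + b) := hg.smul _ (by norm_num) _
        linarith
      rw [hα, hβ, ← add_div, div_le_div_iff₀ hT (by positivity)]
      have : 0 < T' * T := by positivity
      nlinarith
    set μ : R3 →₀ ℝ := Finsupp.single (pt g T a) α + Finsupp.single (pt g T b) β with hμdef
    have hμ : ∀ v, 0 ≤ μ v := fun v => by
      rw [hμdef, Finsupp.add_apply, Finsupp.single_apply, Finsupp.single_apply]
      split_ifs <;> positivity
    have hmass : mass μ = α + β := by simp [hμdef]
    have hm1 : 1 < mass μ := by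
      rw [hmass]
      exact ((one_lt_div hT).2 hlt).trans_le hαβ
    have hbary : bary μ = pt g T' m := by simp [hμdef, hcomb]
    have hsupp : μ.support = {pt g T a, pt g T b} := by
      ext v
      rw [Finsupp.mem_support_iff, hμdef, Finsupp.add_apply, Finsupp.single_apply,
        Finsupp.single_apply, Finset.mem_insert, Finset.mem_singleton]
      split_ifs with h1 h2 h2
      · exact absurd (h1.trans h2.symm) hab
      · simp [hα0.ne', h1.symm]
      · simp [hβ0.ne', h2.symm]
      · simp [Ne.symm h1, Ne.symm h2]
    have hsub : ∀ σ : Finset R3, μ.support ⊆ σ ↔ pt g T a ∈ σ ∧ pt g T b ∈ σ := fun σ => by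
      rw [hsupp, Finset.insert_subset_iff, Finset.singleton_subset_iff]
    have hσ : ∃ σ ∈ 𝒯, μ.support ⊆ σ := ⟨σ₀, hσ₀, (hsub _).2 (by rw [hσe]; simp)⟩
    have hε := angle_pos ℓ
    have H' := H.star hμ hm1 hbary hσ fun σ h1 h2 => by
      obtain ⟨c', h', rfl⟩ := exists_of_hyp_subset hg hT hT' h (htri σ h1) ((hsub σ).1 h2).1
        ((hsub σ).1 h2).2
      obtain ⟨d1, d2, d3⟩ := h'.norm_sub_le
      have e1 : ‖a - m‖ ≤ 3 * angle ℓ := by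
        have : a - m = (1 / 2 : ℝ) • (a - b) := by rw [hm]; module
        rw [this, norm_smul]
        norm_num
        linarith
      have e2 : ‖b - m‖ ≤ 3 * angle ℓ := by
        have : b - m = -((1 / 2 : ℝ) • (a - b)) := by rw [hm]; module
        rw [this, norm_neg, norm_smul]
        norm_num
        linarith
      have e3 : ‖c' - m‖ ≤ 3 * angle ℓ := by
        have : c' - m = -((1 / 2 : ℝ) • ((a - c') + (b - c'))) := by rw [hm]; module
        rw [this, norm_neg, norm_smul]
        have := norm_add_le (a - c') (b - c')
        norm_num at this ⊢
        linarith
      exact (isGoodSimplex_insert hg hη hT hstep.le hstep.ge h' (Or.inl rfl) (Or.inl rfl)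
        (Or.inl rfl) nm e1 e2 e3 (α := α) (β := β) (γ := 0) (by rw [hcomb]; simp) (by simpa using hαβ)).mono hD
    have hgp : g (pt g T' m) = T' := hg.apply_pt_of_normOne hT'.le nm
    refine ih _ ?_ H' (fun σ' hσ' => ?_) rfl
    · rw [← hn]
      refine Finset.card_lt_card (Finset.ssubset_iff_of_subset (fun σ' hσ' => ?_) |>.2
        ⟨σ₀, ?_, ?_⟩)
      · rw [Finset.mem_filter] at hσ' ⊢
        refine ⟨?_, hσ'.2⟩
        rcases mem_starFront.1 hσ'.1 with ⟨h1, -⟩ | ⟨σ₁, h1, h2, i, hi, rfl⟩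
        · exact h1
        · rcases hσ'.2.height hg hT hT (Finset.mem_insert_self _ _) with h | h <;>
          exact absurd (hgp.symm.trans h) hlt.ne'
      · rw [Finset.mem_filter]
        exact ⟨hσ₀, htσ₀⟩
      · rw [Finset.mem_filter, not_and]
        intro hmem
        obtain ⟨-, i, hi, hi'⟩ := H.front.starFront_spec hμ hm1 hbary hσ hmem
        obtain ⟨σ₁, hσ₁, hs⟩ := hσ
        rw [hsupp] at hi
        rw [hσe] at hi'
        simp only [Finset.mem_insert, Finset.mem_singleton] at hi hi'
        exact absurd (hi.elim Or.inl fun h => Or.inr (Or.inl h)) hi'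
    · rcases mem_starFront.1 hσ' with ⟨h1, -⟩ | ⟨σ₁, h1, h2, i, hi, rfl⟩
      · exact htri σ' h1
      · right
        obtain ⟨c', h', rfl⟩ := exists_of_hyp_subset hg hT hT' h (htri σ₁ h1) ((hsub σ₁).1 h2).1
          ((hsub σ₁).1 h2).2
        rw [hsupp, Finset.mem_insert, Finset.mem_singleton] at hi
        rcases hi with rfl | rfl
        · exact h'.isFrontTriangle_bisect hg hT
        · rw [hm, add_comm a b, Finset.insert_comm]
          exact h'.swap.isFrontTriangle_bisect hg hT
  · push Not at hex
    exact ⟨𝒯, 𝒦, H, fun σ h => (htri σ h).resolve_left (hex σ h)⟩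

end

end Growth

/-! ### Construction of the graded mesh. -/

section Construction

open scoped Classical

variable {g : R3 → ℝ} {K η : ℝ} {ℓ : ℕ} {T : ℝ}

lemma isDirTriangle_oct (s : Fin 3 → Bool) :
    IsDirTriangle 0 (octVertex (fun _ _ => 1) 0 (s 0)) (octVertex (fun _ _ => 1) 1 (s 1))
      (octVertex (fun _ _ => 1) 2 (s 2)) := by
  have h0 := sgn_mul_self (s 0)
  have h1 := sgn_mul_self (s 1)
  have h2 := sgn_mul_self (s 2)
  refine ⟨⟨fun i => sgn (s i), fun i => sgn_eq _, ⟨fun i => ?_, ?_⟩, ⟨fun i => ?_, ?_⟩,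
    ⟨fun i => ?_, ?_⟩⟩, ?_, ?_, ?_, ?_⟩
  · fin_cases i <;> simp [octVertex_apply, h0]
  · simp [octVertex_apply, h0]
  · fin_cases i <;> simp [octVertex_apply, h1]
  · simp [octVertex_apply, h1]
  · fin_cases i <;> simp [octVertex_apply, h2]
  · simp [octVertex_apply, h2]
  · simp [projSq, octVertex_apply]; nlinarith
  · rcases sgn_eq (s 0) with h | h <;> simp [projSq, octVertex_apply, h]
  · rcases sgn_eq (s 1) with h | h <;> simp [projSq, octVertex_apply, h]
  · rcases sgn_eq (s 0) with h | h <;> rcases sgn_eq (s 1) with h' | h' <;>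
    rcases sgn_eq (s 2) with h'' | h'' <;> simp [det3, octVertex_apply, h, h', h'']

lemma octFace_eq_pt (g : R3 → ℝ) (T : ℝ) (s : Fin 3 → Bool) :
    octFace (fun i b => T / g (octVertex (fun _ _ => 1) i b)) s =
      {pt g T (octVertex (fun _ _ => 1) 0 (s 0)), pt g T (octVertex (fun _ _ => 1) 1 (s 1)),
        pt g T (octVertex (fun _ _ => 1) 2 (s 2))} := by
  have key : ∀ i b, octVertex (fun i b => T / g (octVertex (fun _ _ => 1) i b)) i b =
      pt g T (octVertex (fun _ _ => 1) i b) := fun i b => by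
    ext j
    simp only [pt, octVertex_apply, PiLp.smul_apply, smul_eq_mul]
    split_ifs <;> ring
  ext v
  simp only [octFace, key, Finset.mem_image, Finset.mem_univ, true_and, Fin.exists_fin_succ,
    Finset.mem_insert, Finset.mem_singleton]
  simp [eq_comm]

/-- The cone from the origin over a small octahedron. -/
theorem exists_seed (hg : IsGauge g K) (hη : 0 < η) (hη1 : η ≤ 1) (hT : 0 < T) {D : ℝ}
    (hD : 37 * K ^ 3 * T ≤ D) :
    ∃ 𝒯 𝒦, IsMesh (regConst K η) D (T / K) 𝒯 𝒦 ∧ ∀ σ ∈ 𝒯, IsFrontTriangle g 0 T T σ := by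
  have hK := hg.one_le
  have hK3 : K ≤ K ^ 3 := le_self_pow₀ hK (by norm_num)
  have hpos : ∀ x, normOne x = 1 → 0 < g x := fun x hx =>
    hg.pos (lt_of_lt_of_le (by norm_num) (half_le_norm_of_normOne hx))
  have hvert : ∀ i b, normOne (octVertex (fun _ _ => 1) i b) = 1 := by
    intro i b
    obtain ⟨h0, h1, h2⟩ := (isDirTriangle_oct fun _ => b).normOne_eq
    fin_cases i <;> assumption
  set c : Fin 3 → Bool → ℝ := fun i b => T / g (octVertex (fun _ _ => 1) i b) with hc
  have hc0 : ∀ i b, 0 < c i b := fun i b => div_pos hT (hpos _ (hvert i b))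
  refine ⟨octFront c, octTets c, ⟨isFront_oct hc0, ?_, ?_⟩, ?_⟩
  · simp only [octTets, Finset.mem_image, Finset.mem_univ, true_and]
    rintro _ ⟨s, rfl⟩
    rw [hc, octFace_eq_pt]
    have h := isDirTriangle_oct s
    obtain ⟨na, nb, nc⟩ := h.normOne_eq
    set a := octVertex (fun _ _ => 1) 0 (s 0)
    set b := octVertex (fun _ _ => 1) 1 (s 1)
    set d := octVertex (fun _ _ => 1) 2 (s 2)
    have hn : ∀ x, normOne x = 1 → ‖pt g T x‖ ≤ K * T := fun x hx => by
      have := hg.norm_le (pt g T x)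
      rwa [hg.apply_pt_of_normOne hT.le hx] at this
    have hKT : K * T ≤ K ^ 3 * T := by gcongr
    have hKT0 : 0 < K ^ 3 * T := by positivity
    have h1 : ∀ x, normOne x = 1 → ‖pt g T x - 0‖ ≤ 37 * K ^ 3 * T := fun x hx => by
      rw [sub_zero]
      linarith [hn x hx]
    have h2 : ∀ x y, normOne x = 1 → normOne y = 1 → ‖pt g T x - pt g T y‖ ≤ 37 * K ^ 3 * T :=
      fun x y hx hy => by linarith [norm_sub_le (pt g T x) (pt g T y), hn x hx, hn y hy]
    refine IsGoodSimplex.mono (isGoodSimplex_of_det (by positivity) (by positivity) (h1 _ na)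
      (h1 _ nb) (h1 _ nc) (h2 _ _ na nb) (h2 _ _ na nc) (h2 _ _ nb nc) ?_) hD
    rw [sub_zero, sub_zero, sub_zero, pt, pt, pt, det3_smul, abs_mul, h.det, pow_zero, mul_one]
    have coef : ∀ x, normOne x = 1 → T / K ≤ T / g x := by
      intro x hx
      have hgx := hpos x hx
      have hgK : g x ≤ K := (hg.le_norm x).trans (by nlinarith [norm_le_of_normOne hx])
      gcongr
    refine le_trans ?_ (le_abs_self _)
    have hTK : 0 < T / K := by positivity
    calc η / (37 ^ 3 * K ^ 12) * (37 * K ^ 3 * T) ^ 3 = η * (T / K) ^ 3 := by field_simp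
      _ ≤ 1 * (T / K) ^ 3 := by gcongr
      _ = T / K * (T / K) * (T / K) := by ring
      _ ≤ _ := by
        have h12 := mul_le_mul (coef a na) (coef b nb) hTK.le (hTK.le.trans (coef a na))
        exact mul_le_mul h12 (coef d nc) hTK.le ((mul_nonneg hTK.le hTK.le).trans h12)
  · refine ⟨_, Finset.mem_image_of_mem _ (Finset.mem_univ fun _ => true), ?_⟩
    rw [hc, octFace_eq_pt]
    have h := isDirTriangle_oct fun _ => true
    obtain ⟨na, -, -⟩ := h.normOne_eq
    set a := octVertex (fun _ _ => 1) 0 true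
    have hle : T / K ≤ dist (pt g T a) 0 := by
      rw [dist_zero_right, div_le_iff₀ (by positivity), mul_comm]
      have := hg.le_norm (pt g T a)
      rwa [hg.apply_pt_of_normOne hT.le na] at this
    refine hle.trans ?_
    rw [convexHull_diam]
    exact Metric.dist_le_diam_of_mem (Finset.finite_toSet _).isBounded (by simp) (by simp)
  · simp only [octFront, Finset.mem_image, Finset.mem_univ, true_and]
    rintro _ ⟨s, rfl⟩
    exact ⟨_, _, _, T, T, T, isDirTriangle_oct s, Or.inl rfl, Or.inl rfl, Or.inl rfl,
      octFace_eq_pt g T s⟩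

lemma rho_bounds : 7 / 10 ≤ rho ^ 2 ∧ 7 / 10 ≤ rho ∧ rho ≤ 9 / 10 := by
  have h := rho_sq_sq
  have h0 := rho_pos
  have h1 := rho_lt_one
  have h2 : 7 / 10 ≤ rho ^ 2 := by
    by_contra hlt
    push Not at hlt
    nlinarith [sq_nonneg rho]
  refine ⟨h2, by nlinarith, ?_⟩
  by_contra hlt
  push Not at hlt
  have : 81 / 100 ≤ rho ^ 2 := by nlinarith
  nlinarith

/-- One bisection of the front while its height grows by the factor `rho⁻¹`. -/
theorem IsMesh.level (hg : IsGauge g K) (hT : 0 < T) {D δ : ℝ}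
    (hD : 74 * K ^ 3 * (angle ℓ * T) ≤ D) {𝒯 𝒦 : Finset (Finset R3)}
    (H : IsMesh (regConst K (1 / 40)) D δ 𝒯 𝒦) (htri : ∀ σ ∈ 𝒯, IsFrontTriangle g ℓ T T σ) :
    ∃ 𝒯' 𝒦', IsMesh (regConst K (1 / 40)) D δ 𝒯' 𝒦' ∧
      ∀ σ ∈ 𝒯', IsFrontTriangle g (ℓ + 1) (T / rho) (T / rho) σ := by
  have hK := hg.one_le
  have hε := angle_pos ℓ
  have hε1 := angle_le_one ℓ
  obtain ⟨r1, r2, r3⟩ := rho_bounds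
  have hr := rho_pos
  have hang : angle (ℓ + 1) = angle ℓ * rho ^ 2 := pow_succ _ _
  -- About `1 / angle ℓ` layers of equal thickness `e` lead from height `T` to `T / rho`, so each is
  -- comparable in thickness to the triangle size `angle ℓ * T`.
  set n := ⌈(angle ℓ)⁻¹⌉₊ with hn
  have hn1 : (angle ℓ)⁻¹ ≤ n := Nat.le_ceil _
  have hn2 : (n : ℝ) < (angle ℓ)⁻¹ + 1 := Nat.ceil_lt_add_one (by positivity)
  have hinv : 1 ≤ (angle ℓ)⁻¹ := (one_le_inv₀ hε).2 hε1
  have hn0 : 0 < (n : ℝ) := by linarith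
  have hnpos : 0 < n := by exact_mod_cast hn0
  have hna : 1 ≤ n * angle ℓ := by
    rwa [← inv_le_iff_one_le_mul₀ hε]
  have hna2 : n * angle ℓ ≤ 2 := by
    have : (n : ℝ) * angle ℓ ≤ ((angle ℓ)⁻¹ + 1) * angle ℓ := by gcongr
    rw [add_mul, inv_mul_cancel₀ hε.ne'] at this
    linarith
  set e : ℝ := T * (1 / rho - 1) / n with he
  have q1 : 1 / rho - 1 ≤ 1 / 2 := by
    rw [sub_le_iff_le_add, div_le_iff₀ hr]
    linarith
  have q2 : 1 / 10 ≤ 1 / rho - 1 := by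
    rw [le_sub_iff_add_le, le_div_iff₀ hr]
    linarith
  have he0 : 0 < e := div_pos (mul_pos hT (by linarith)) hn0
  have hne : n * e = T * (1 / rho - 1) := by rw [he]; field_simp
  -- Lower bound: heights stay below `2 * T`, `1 / rho - 1 ≥ 1 / 10` and `n * angle ℓ ≤ 2`, whence
  -- `1 / 40`. Upper bound: `1 / rho - 1 ≤ 1 / 2`, while one bisection shrinks the angle by no more
  -- than the factor `rho ^ 2 ≥ 7 / 10`.
  have hstep : ∀ i : ℕ, i ≤ n → ∀ k, angle ℓ * rho ^ 2 ≤ angle k → angle k ≤ angle ℓ →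
      IsStep (1 / 40) k (T + i * e) (T + (i + 1) * e) := by
    intro i hi k hk1 hk2
    have hi' : (i : ℝ) ≤ n := by exact_mod_cast hi
    have hie : i * e ≤ T := by
      have : (i : ℝ) * e ≤ n * e := by gcongr
      nlinarith
    have hie0 : 0 ≤ i * e := by positivity
    have hk0 := angle_pos k
    refine ⟨by linarith, ?_, ?_⟩
    · have : angle k * (T + i * e) ≤ angle ℓ * (2 * T) := by gcongr; linarith
      have h3 : T / 20 * angle ℓ ≤ e := by
        rw [he, le_div_iff₀ hn0]
        nlinarith [mul_le_mul_of_nonneg_left hna2 hT.le]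
      linarith
    · have h3 : e ≤ T * (7 / 10) * angle ℓ := by
        rw [he, div_le_iff₀ hn0]
        nlinarith [mul_le_mul_of_nonneg_left hna hT.le]
      have h4 : angle ℓ * (7 / 10) ≤ angle k := le_trans (by gcongr) hk1
      nlinarith [mul_nonneg hk0.le hie0, mul_le_mul_of_nonneg_left h4 hT.le]
  have hle : angle ℓ * rho ^ 2 ≤ angle ℓ := by nlinarith [rho_lt_one]
  have hDk : ∀ i : ℕ, i ≤ n → ∀ k, angle k ≤ angle ℓ →
      37 * K ^ 3 * (angle k * (T + i * e)) ≤ D := by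
    intro i hi k hk
    have hi' : (i : ℝ) ≤ n := by exact_mod_cast hi
    have hie : i * e ≤ T := by
      have : (i : ℝ) * e ≤ n * e := by gcongr
      nlinarith
    have hie0 : 0 ≤ i * e := by positivity
    calc 37 * K ^ 3 * (angle k * (T + i * e)) ≤ 37 * K ^ 3 * (angle ℓ * (T + T)) := by gcongr
      _ = 74 * K ^ 3 * (angle ℓ * T) := by ring
      _ ≤ D := hD
  have main : ∀ i : ℕ, i < n → ∃ 𝒯' 𝒦', IsMesh (regConst K (1 / 40)) D δ 𝒯' 𝒦' ∧
      ∀ σ ∈ 𝒯', IsFrontTriangle g (ℓ + 1) (T + (i + 1) * e) (T + (i + 1) * e) σ := by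
    intro i
    induction i with
    -- The first layer bisects, placing the midpoints on the next level, and then raises the
    -- remaining vertices. The other layers only raise.
    | zero =>
      intro _
      have s0 := hstep 0 (Nat.zero_le _) ℓ hle le_rfl
      have s1 := hstep 0 (Nat.zero_le _) (ℓ + 1) hang.ge (hang.le.trans hle)
      have d0 := hDk 0 (Nat.zero_le _) ℓ le_rfl
      have d1 := hDk 0 (Nat.zero_le _) (ℓ + 1) (hang.le.trans hle)
      simp only [Nat.cast_zero, zero_mul, add_zero] at s0 s1 d0 d1 ⊢
      obtain ⟨𝒯₁, 𝒦₁, H₁, h₁⟩ := H.bisect hg (by norm_num) s0 d0 fun σ h => Or.inl (htri σ h)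
      exact H₁.raise hg (by norm_num) s1 d1 h₁
    | succ i ih =>
      intro hi
      obtain ⟨𝒯₁, 𝒦₁, H₁, h₁⟩ := ih (by omega)
      have s1 := hstep (i + 1) hi.le (ℓ + 1) hang.ge (hang.le.trans hle)
      have d1 := hDk (i + 1) hi.le (ℓ + 1) (hang.le.trans hle)
      push_cast at s1 d1 ⊢
      refine H₁.raise hg (by norm_num) s1 d1 fun σ h => ?_
      obtain ⟨a, b, c, ta, tb, tc, h, ha, hb, hc, hσ⟩ := h₁ σ h
      exact ⟨a, b, c, ta, tb, tc, h, Or.inl (or_self_iff.1 ha), Or.inl (or_self_iff.1 hb),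
        Or.inl (or_self_iff.1 hc), hσ⟩
  obtain ⟨𝒯', 𝒦', H', h'⟩ := main (n - 1) (by omega)
  have hcast : ((n - 1 : ℕ) : ℝ) + 1 = n := by
    rw [Nat.cast_sub (by omega)]
    simp
  have hfin : T + n * e = T / rho := by rw [hne]; ring
  rw [hcast, hfin] at h'
  exact ⟨𝒯', 𝒦', H', h'⟩

/-- Graded meshes: the size of the triangles of the front is the square of the maximal mesh size. -/
theorem exists_graded_mesh (hg : IsGauge g K) (L : ℕ) :
    ∃ 𝒯 𝒦, IsMesh (regConst K (1 / 40)) (74 * K ^ 3 * rho ^ L) (rho ^ L / K) 𝒯 𝒦 ∧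
      ∀ σ ∈ 𝒯, IsFrontTriangle g L 1 1 σ := by
  have hr := rho_pos
  have hK := hg.one_le
  have key : ∀ ℓ : ℕ, ∃ 𝒯 𝒦, IsMesh (regConst K (1 / 40)) (74 * K ^ 3 * rho ^ L) (rho ^ L / K) 𝒯 𝒦 ∧
      ∀ σ ∈ 𝒯, IsFrontTriangle g ℓ (rho ^ L / rho ^ ℓ) (rho ^ L / rho ^ ℓ) σ := by
    intro ℓ
    induction ℓ with
    | zero =>
      rw [pow_zero, div_one]
      exact exists_seed hg (by norm_num) (by norm_num) (by positivity) (by gcongr; norm_num)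
    | succ ℓ ih =>
      obtain ⟨𝒯, 𝒦, H, h⟩ := ih
      have := H.level hg (by positivity) (ℓ := ℓ) ?_ h
      · rwa [div_div, ← pow_succ] at this
      -- Front triangles have size of order `rho ^ (ℓ + L)`, largest at `ℓ = 0`; one bound `D`
      -- therefore serves all levels.
      · have e : angle ℓ * (rho ^ L / rho ^ ℓ) = rho ^ ℓ * rho ^ L := by
          rw [angle, ← pow_mul, two_mul, pow_add]
          field_simp
        rw [e]
        have h1 : rho ^ ℓ ≤ 1 := pow_le_one₀ hr.le rho_lt_one.le
        have h2 : rho ^ ℓ * rho ^ L ≤ 1 * rho ^ L := by gcongr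
        rw [one_mul] at h2
        gcongr
  have := key L
  rwa [div_self (by positivity)] at this

end Construction

/-! ### Comparison of the body with the convex domain. -/

section Approximation

open scoped Classical

variable {g : R3 → ℝ} {K : ℝ} {𝒯 : Finset (Finset R3)} {L : ℕ}

lemma IsGauge.apply_bary_le (hg : IsGauge g K) {σ : Finset R3} (hσ : ∀ P ∈ σ, g P = 1)
    {w : R3 →₀ ℝ} (hw : WeightsOn σ w) : g (bary w) ≤ mass w := by
  have h0 : g 0 = 0 := by simpa using hg.smul 0 le_rfl 0
  rw [bary_eq_sum hw.2, mass_eq_sum hw.2]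
  refine (Finset.le_sum_of_subadditive g h0.le hg.add_le _ _).trans
    (Finset.sum_le_sum fun P hP => ?_)
  rw [hg.smul _ (hw.1 P), hσ P hP, mul_one]

lemma IsFrontTriangle.apply_eq_one (hg : IsGauge g K) {σ : Finset R3}
    (hσ : IsFrontTriangle g L 1 1 σ) : ∀ P ∈ σ, g P = 1 := fun _ hP =>
  or_self_iff.1 (hσ.height hg one_pos one_pos hP)

lemma BelowFront.apply_lt_one (hg : IsGauge g K) (h : ∀ σ ∈ 𝒯, IsFrontTriangle g L 1 1 σ) {x : R3}
    (hx : BelowFront 𝒯 x) : g x < 1 := by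
  obtain ⟨σ, hσ, w, hw, rfl, hlt⟩ := hx
  exact (hg.apply_bary_le ((h σ hσ).apply_eq_one hg) hw).trans_lt hlt

lemma IsFrontTriangle.norm_sub_le (hg : IsGauge g K) {σ : Finset R3}
    (hσ : IsFrontTriangle g L 1 1 σ) {P Q : R3} (hP : P ∈ σ) (hQ : Q ∈ σ) :
    ‖P - Q‖ ≤ 18 * K ^ 3 * angle L := by
  obtain ⟨a, b, c, ta, tb, tc, h, ha, hb, hc, rfl⟩ := hσ
  rw [or_self_iff] at ha hb hc
  subst ha hb hc
  have hK := hg.one_le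
  have hε := angle_pos L
  obtain ⟨na, nb, nc⟩ := h.normOne_eq
  obtain ⟨dab, dac, dbc⟩ := h.norm_sub_le
  have key : ∀ x y, normOne x = 1 → normOne y = 1 → ‖x - y‖ ≤ 3 * angle L →
      ‖pt g 1 x - pt g 1 y‖ ≤ 18 * K ^ 3 * angle L := by
    intro x y hx hy hxy
    refine (hg.norm_pt_sub_le zero_le_one (half_le_norm_of_normOne hx)
      (half_le_norm_of_normOne hy) (norm_le_of_normOne hy)).trans ?_
    rw [sub_self, abs_zero, mul_zero, zero_add, mul_one]
    calc 6 * K ^ 3 * ‖x - y‖ ≤ 6 * K ^ 3 * (3 * angle L) := by gcongr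
      _ = _ := by ring
  have h0 : ∀ x : R3, ‖x - x‖ ≤ 18 * K ^ 3 * angle L := fun x => by
    rw [sub_self, norm_zero]; positivity
  simp only [Finset.mem_insert, Finset.mem_singleton] at hP hQ
  rcases hP with rfl | rfl | rfl <;> rcases hQ with rfl | rfl | rfl
  · exact h0 _
  · exact key _ _ na nb dab
  · exact key _ _ na nc dac
  · exact key _ _ nb na (by rwa [norm_sub_rev])
  · exact h0 _
  · exact key _ _ nb nc dbc
  · exact key _ _ nc na (by rwa [norm_sub_rev])
  · exact key _ _ nc nb (by rwa [norm_sub_rev])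
  · exact h0 _

/-- Scaling `x` down by its mass puts it on a front triangle, close to a vertex where `g = 1`; the
Lipschitz bound applies there, and scaling back up only increases `g`. -/
lemma IsFront.le_apply_of_not_belowFront (hg : IsGauge g K) {𝒦 : Finset (Finset R3)}
    (H : IsFront 𝒯 𝒦) (h : ∀ σ ∈ 𝒯, IsFrontTriangle g L 1 1 σ) {x : R3} (hx : ¬ BelowFront 𝒯 x) :
    1 - 18 * K ^ 4 * angle L ≤ g x := by
  have hK := hg.one_le
  obtain ⟨σ, hσ, w, hw, rfl⟩ := H.cone_cover x
  have hm : 1 ≤ mass w := by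
    by_contra hlt
    exact hx ⟨σ, hσ, w, hw, rfl, not_le.1 hlt⟩
  have hm0 : 0 < mass w := by linarith
  obtain ⟨P, hP⟩ : σ.Nonempty := by
    rw [← Finset.card_pos, H.card_front σ hσ]
    norm_num
  have hy : (mass w)⁻¹ • bary w ∈ Metric.closedBall P (18 * K ^ 3 * angle L) := by
    have hmem : (mass w)⁻¹ • bary w ∈ convexHull ℝ (σ : Set R3) := by
      refine mem_convexHull_iff_weightsOn.2 ⟨(mass w)⁻¹ • w, ⟨fun v => ?_, fun v hv => ?_⟩, ?_, ?_⟩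
      · have := hw.1 v
        simp only [Finsupp.smul_apply, smul_eq_mul]
        positivity
      · simp [hw.2 v hv]
      · simp [hm0.ne']
      · simp
    refine convexHull_min (fun Q hQ => ?_) (convex_closedBall _ _) hmem
    rw [Metric.mem_closedBall, dist_eq_norm]
    exact (h σ hσ).norm_sub_le hg hQ hP
  rw [Metric.mem_closedBall, dist_eq_norm] at hy
  have h1 := (abs_le.1 (hg.abs_sub_le ((mass w)⁻¹ • bary w) P)).1
  rw [(h σ hσ).apply_eq_one hg P hP] at h1
  have h2 : K * ‖(mass w)⁻¹ • bary w - P‖ ≤ K * (18 * K ^ 3 * angle L) := by gcongr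
  have h3 : g ((mass w)⁻¹ • bary w) ≤ g (bary w) := by
    rw [hg.smul _ (by positivity)]
    have : 0 ≤ g (bary w) := by
      have h4 := hg.norm_le (bary w)
      have h5 := norm_nonneg (bary w)
      by_contra hneg
      nlinarith [not_le.1 hneg]
    exact mul_le_of_le_one_left this (inv_le_one_of_one_le₀ hm)
  nlinarith

/-- The gauge of a bounded convex neighbourhood of the origin. -/
lemma exists_isGauge {U : Set R3} (hconv : Convex ℝ U) (hopen : IsOpen U)
    (hbdd : Bornology.IsBounded U) (h0 : (0 : R3) ∈ U) : ∃ K, IsGauge (gauge U) K := by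
  have hnhds : U ∈ 𝓝 (0 : R3) := hopen.mem_nhds h0
  have habs : Absorbent ℝ U := absorbent_nhds_zero hnhds
  obtain ⟨r, hr, hball⟩ := Metric.isOpen_iff.1 hopen 0 h0
  obtain ⟨R, hR⟩ := hbdd.subset_closedBall 0
  have hR1 : U ⊆ Metric.closedBall 0 (max R 1) :=
    hR.trans (Metric.closedBall_subset_closedBall (le_max_left _ _))
  have hR0 : 0 < max R 1 := lt_max_of_lt_right one_pos
  -- `K` must dominate `1`, an outer radius and the inverse of an inner radius of the domain.
  refine ⟨max (max R 1) r⁻¹, (le_max_right R 1).trans (le_max_left _ _),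
    fun x y => gauge_add_le hconv habs x y, fun t ht x => ?_, fun x => ?_, fun x => ?_⟩
  · rw [gauge_smul_of_nonneg ht, smul_eq_mul]
  · have := mul_gauge_le_norm (x := x) hball
    calc gauge U x = r⁻¹ * (r * gauge U x) := by rw [inv_mul_cancel_left₀ hr.ne']
      _ ≤ r⁻¹ * ‖x‖ := by gcongr
      _ ≤ _ := by gcongr; exact le_max_right _ _
  · have := le_gauge_of_subset_closedBall habs hR0.le hR1 (x := x)
    rw [div_le_iff₀ hR0, mul_comm] at this
    exact this.trans (mul_le_mul_of_nonneg_right (le_max_left _ _) (gauge_nonneg x))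

/-- Compare with the radial projection `(gauge U x)⁻¹ • x`, a boundary point of norm at most `K`. -/
lemma infDist_frontier_le_of_gauge {U : Set R3} (hconv : Convex ℝ U) (hnhds : U ∈ 𝓝 (0 : R3))
    (hg : IsGauge (gauge U) K) {x : R3} (hx : x ≠ 0) (hx1 : gauge U x ≤ 1) :
    Metric.infDist x (frontier U) ≤ K * (1 - gauge U x) := by
  have hpos := hg.pos (norm_pos_iff.2 hx)
  set y := (gauge U x)⁻¹ • x with hy
  have hgy : gauge U y = 1 := by
    rw [hy, hg.smul _ (by positivity), inv_mul_cancel₀ hpos.ne']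
  have hyf : y ∈ frontier U := (gauge_eq_one_iff_mem_frontier hconv hnhds).1 hgy
  refine (Metric.infDist_le_dist_of_mem hyf).trans ?_
  have hxy : x - y = -((1 - gauge U x) • y) := by
    rw [sub_smul, one_smul, hy, smul_smul, mul_inv_cancel₀ hpos.ne', one_smul]
    abel
  rw [dist_eq_norm, hxy, norm_neg, norm_smul, Real.norm_eq_abs, abs_of_nonneg (by linarith),
    mul_comm]
  have := hg.norm_le y
  rw [hgy, mul_one] at this
  gcongr

/-- A convex open set has a support plane at every point of its boundary. -/
lemma hasSupportPlaneAt_of_notMem {U V : Set R3} (hconv : Convex ℝ U) (hopen : IsOpen U)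
    (hne : U.Nonempty) (hV : V ⊆ U) {z : R3} (hz : z ∉ U) : HasSupportPlaneAt V z := by
  obtain ⟨f, hf⟩ := geometric_hahn_banach_open_point hconv hopen hz
  refine ⟨(InnerProductSpace.toDual ℝ R3).symm f, fun h => ?_, fun x hx => ?_⟩
  · rw [LinearIsometryEquiv.map_eq_zero_iff] at h
    obtain ⟨x, hx⟩ := hne
    have := hf x hx
    simp [h] at this
  · rw [real_inner_comm, InnerProductSpace.toDual_symm_apply, map_sub]
    linarith [hf x (hV hx)]

/-- An open bounded set is exhausted, up to sets of small measure, by the points whose distance to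
the boundary is not too small. -/
lemma tendsto_volume_infDist_frontier {U : Set R3} (hopen : IsOpen U)
    (hbdd : Bornology.IsBounded U) (hfr : (frontier U).Nonempty) {d : ℕ → ℝ}
    (hd : Tendsto d atTop (𝓝 0)) :
    Tendsto (fun n => volume (U ∩ {x | Metric.infDist x (frontier U) ≤ d n})) atTop (𝓝 0) := by
  have hfin : volume U ≠ ⊤ := hbdd.measure_lt_top.ne
  have hms : ∀ r : ℝ, MeasurableSet {x | Metric.infDist x (frontier U) ≤ r} := fun r =>
    measurableSet_le (Metric.continuous_infDist_pt _).measurable measurable_const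
  have hmem : ∀ x ∈ U, 0 < Metric.infDist x (frontier U) := fun x hx => by
    rw [← (isClosed_frontier).notMem_iff_infDist_pos hfr]
    intro h
    rw [hopen.frontier_eq] at h
    exact h.2 hx
  have h := tendsto_measure_of_tendsto_indicator (μ := volume) (L := atTop)
    (As := fun n => U ∩ {x | Metric.infDist x (frontier U) ≤ d n}) (A := ∅) (B := U)
    (fun n => hopen.measurableSet.inter (hms _)) hopen.measurableSet hfin
    (Eventually.of_forall fun n => inter_subset_left) fun x => ?_
  · simpa using h
  · by_cases hx : x ∈ U
    · filter_upwards [hd.eventually (gt_mem_nhds (hmem x hx))] with n hn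
      simp only [mem_inter_iff, mem_ofPred_eq, mem_empty_iff_false, iff_false, not_and, not_le]
      exact fun _ => hn
    · exact Eventually.of_forall fun n => by simp [hx]

/-- Approximation of a convex domain by the bodies of graded meshes. -/
theorem exists_discreteConvex_approximation {Ω : Set R3} (hne : Ω.Nonempty) (hconv : Convex ℝ Ω)
    (hopen : IsOpen Ω) (hbdd : Bornology.IsBounded Ω) :
    ∃ c κ C : ℝ, 0 < c ∧ (frontier Ω).Nonempty ∧ ∀ L : ℕ, ∃ (h : ℝ) (V : Set R3)
      (X : Geometry.SimplicialComplex ℝ R3), 0 < h ∧ h ≤ C * rho ^ L ∧ IsOpen V ∧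
        IsDiscreteConvex X V ∧ HasMaximalMeshSize X h ∧ IsShapeRegular X κ ∧ V ⊆ Ω ∧
        symmDiff V Ω ⊆ {x | Metric.infDist x (frontier Ω) ≤ c * h ^ 2} := by
  obtain ⟨x₀, hx₀⟩ := hne
  set e := IsometryEquiv.addRight x₀ with he
  have hee : (e : R3 → R3) = fun v => v + x₀ := rfl
  obtain ⟨U, rfl⟩ : ∃ U, Ω = e '' U := ⟨e ⁻¹' Ω, (e.image_preimage Ω).symm⟩
  have hUopen : IsOpen U := e.toHomeomorph.isOpen_image.1 hopen
  have hU0 : (0 : R3) ∈ U := by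
    obtain ⟨u, hu, h⟩ := hx₀
    have : u = 0 := by simpa [hee] using h
    rwa [← this]
  have hUconv : Convex ℝ U := by
    have := hconv.translate_preimage_left x₀
    rwa [← hee, preimage_image_eq _ e.injective] at this
  have hUbdd : Bornology.IsBounded U := by
    have := e.symm.isometry.lipschitz.isBounded_image hbdd
    rwa [← image_comp, e.symm_comp_self, image_id] at this
  have hfr : frontier (e '' U) = e '' frontier U := (e.toHomeomorph.image_frontier U).symm
  have hnhds : U ∈ 𝓝 (0 : R3) := hUopen.mem_nhds hU0
  obtain ⟨K, hg⟩ := exists_isGauge hUconv hUopen hUbdd hU0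
  have hK := hg.one_le
  have hmemU : ∀ x, x ∈ U ↔ gauge U x < 1 := fun x => by
    rw [gauge_lt_one_iff_mem_interior hUconv hnhds, hUopen.interior_eq]
  have hne' : (e '' U).Nonempty := ⟨_, mem_image_of_mem _ hU0⟩
  refine ⟨18 * K ^ 7, regConst K (1 / 40), 74 * K ^ 3, by positivity, ?_, fun L => ?_⟩
  · rw [hfr]
    have h1 := (isDirTriangle_oct fun _ => true).normOne_eq.1
    refine Nonempty.image _ ⟨_, (gauge_eq_one_iff_mem_frontier hUconv hnhds).1
      (hg.apply_pt_of_normOne zero_le_one h1)⟩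
  obtain ⟨𝒯, 𝒦, H, htri⟩ := exists_graded_mesh hg L
  have hF := H.front
  have hX : UniqueWeights (translateTets x₀ 𝒦) := UniqueWeights.translate hF.unique x₀
  have hcard : ∀ s ∈ translateTets x₀ 𝒦, s.card = 4 := by
    intro s hs
    obtain ⟨t, ht, rfl⟩ := mem_translateTets.1 hs
    rw [Finset.card_image_of_injective _ (add_left_injective x₀), hF.card_tet t ht]
  have htet := hX.tetrahedra_complex hcard
  have hdiam : ∀ s : Finset R3,
      Metric.diam (convexHull ℝ ((s.image fun v => v + x₀ : Finset R3) : Set R3)) =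
        Metric.diam (convexHull ℝ (s : Set R3)) := fun s => by
    rw [convexHull_image_add, ← hee, e.isometry.diam_image]
  obtain ⟨s₁, hs₁, hbig⟩ := H.big
  obtain ⟨s₀, hs₀, hmax⟩ := Finset.exists_max_image 𝒦
    (fun s => Metric.diam (convexHull ℝ (s : Set R3))) ⟨s₁, hs₁⟩
  set h := Metric.diam (convexHull ℝ (s₀ : Set R3)) with hh
  have hr : 0 < rho ^ L := pow_pos rho_pos L
  have hlow : rho ^ L / K ≤ h := hbig.trans (hmax s₁ hs₁)
  have hint := hF.interior_hullUnion
  have hsub : e '' interior (hullUnion 𝒦) ⊆ e '' U := by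
    refine image_mono fun x hx => ?_
    rw [hint] at hx
    exact (hmemU x).2 (BelowFront.apply_lt_one hg htri hx)
  have hVopen : IsOpen (e '' interior (hullUnion 𝒦)) :=
    e.toHomeomorph.isOpen_image.2 isOpen_interior
  refine ⟨h, e '' interior (hullUnion 𝒦), hX.complex, lt_of_lt_of_le (by positivity) hlow,
    (H.good s₀ hs₀).2, hVopen, ⟨hF.isTriangulation x₀ hX, ?_⟩, ⟨?_, ?_⟩, ?_, hsub, ?_⟩
  · rintro z ⟨hz, hzf⟩
    obtain ⟨t, ht, hzt⟩ := hX.mem_vertices_complex.1 hz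
    obtain ⟨s, hs, rfl⟩ := mem_translateTets.1 ht
    obtain ⟨z₀, hz₀, rfl⟩ := Finset.mem_image.1 hzt
    refine hasSupportPlaneAt_of_notMem hconv hopen hne' hsub ?_
    change e z₀ ∉ _
    rw [e.injective.mem_set_image, hmemU]
    -- Every vertex of the mesh is either on the final front, where the gauge is `1`, or interior to
    -- the body; the latter is excluded for a boundary vertex.
    rcases hF.vert s hs z₀ hz₀ with ⟨σ, hσ, hzσ⟩ | hb
    · rw [(htri σ hσ).apply_eq_one hg z₀ hzσ]
      exact lt_irrefl _
    · rw [hVopen.frontier_eq] at hzf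
      refine absurd (mem_image_of_mem e ?_) hzf.2
      rw [hint]
      exact hb
  · rw [htet]
    exact ⟨_, mem_translateTets.2 ⟨s₀, hs₀, rfl⟩, hdiam s₀⟩
  · rw [htet]
    rintro _ ⟨t, ht, rfl⟩
    obtain ⟨s, hs, rfl⟩ := mem_translateTets.1 ht
    exact (hdiam s).trans_le (hmax s hs)
  · intro t ht
    rw [htet] at ht
    obtain ⟨s, hs, rfl⟩ := mem_translateTets.1 ht
    obtain ⟨⟨x, r, hr0, hball, hκ⟩, -⟩ := H.good s hs
    refine ⟨e x, r, hr0, ?_, (hdiam s).trans_le hκ⟩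
    rw [convexHull_image_add, ← hee, ← e.image_closedBall]
    exact image_mono hball
  · rw [Set.symmDiff_def, sdiff_eq_bot_iff.2 hsub]
    rintro _ (hx | ⟨⟨x, hx, rfl⟩, hx'⟩)
    · exact absurd hx (by simp)
    · rw [e.injective.mem_set_image, hint] at hx'
      have hle := hF.le_apply_of_not_belowFront hg htri hx'
      have hx0 : x ≠ 0 := by
        rintro rfl
        exact hx' hF.belowFront_zero
      rw [mem_ofPred_eq, hfr, Metric.infDist_image e.isometry]
      refine (infDist_frontier_le_of_gauge hUconv hnhds hg hx0 ((hmemU x).1 hx).le).trans ?_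
      -- Here the grading pays off: `angle L = (rho ^ L) ^ 2`, and the big tetrahedron kept from the
      -- seed bounds `rho ^ L` by `K * h`.
      have hang : angle L ≤ (K * h) ^ 2 := by
        rw [angle, ← pow_mul, mul_comm, pow_mul]
        have : rho ^ L ≤ K * h := by
          rwa [div_le_iff₀ (by positivity), mul_comm] at hlow
        gcongr
      calc K * (1 - gauge U x) ≤ K * (18 * K ^ 4 * (K * h) ^ 2) := by
            gcongr
            have : 18 * K ^ 4 * angle L ≤ 18 * K ^ 4 * (K * h) ^ 2 := by gcongr
            linarith
        _ = 18 * K ^ 7 * h ^ 2 := by ring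

end Approximation

/-! ### The theorem: mesh sizes tending to zero and convergence in `L¹`. -/

/-- The meshes are graded: their largest tetrahedra have diameter `h`, and those at the boundary have
diameter of order `h ^ 2`, so that the hypothesis `hC2` is not needed. -/
theorem mainTheorem4 (Ω : Set R3) (hne : Ω.Nonempty) (hconv : Convex ℝ Ω) (hopen : IsOpen Ω)
    (hbdd : Bornology.IsBounded Ω) (hC2 : HasPiecewiseC2Boundary Ω) :
    ∃ (c κ : ℝ) (h : ℕ → ℝ) (Ωh : ℕ → Set R3) (K : ℕ → Geometry.SimplicialComplex ℝ R3),
      0 < c ∧ (∀ n, 0 < h n) ∧ Tendsto h atTop (𝓝 0) ∧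
      (∀ n, IsDiscreteConvex (K n) (Ωh n) ∧
        HasMaximalMeshSize (K n) (h n) ∧
        IsShapeRegular (K n) κ ∧
        Ωh n ⊆ Ω ∧
        symmDiff (Ωh n) Ω ⊆ {x | Metric.infDist x (frontier Ω) ≤ c * h n ^ 2}) ∧
      Tendsto (fun n => eLpNorm
        ((Ωh n).indicator (fun _ => (1 : ℝ)) - Ω.indicator (fun _ => (1 : ℝ))) 1 volume)
        atTop (𝓝 0) := by
  obtain ⟨c, κ, C, hc, hfr, H⟩ := exists_discreteConvex_approximation hne hconv hopen hbdd
  choose h V X hpos hle hV hX hmesh hreg hsub hdiff using H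
  have hlim : Tendsto h atTop (𝓝 0) := by
    refine squeeze_zero (fun n => (hpos n).le) hle ?_
    simpa using (tendsto_pow_atTop_nhds_zero_of_lt_one rho_pos.le rho_lt_one).const_mul C
  refine ⟨c, κ, h, V, X, hc, hpos, hlim, fun n => ⟨hX n, hmesh n, hreg n, hsub n, hdiff n⟩, ?_⟩
  have hd : Tendsto (fun n => c * h n ^ 2) atTop (𝓝 0) := by
    simpa using (hlim.pow 2).const_mul c
  -- The `L¹` distance is the volume of the difference set, which lies in a boundary layer of
  -- thickness `c * h n ^ 2` inside the domain.
  refine tendsto_of_tendsto_of_tendsto_of_le_of_le tendsto_const_nhds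
    (tendsto_volume_infDist_frontier hopen hbdd hfr hd) (fun _ => zero_le) fun n => ?_
  have hms : MeasurableSet (Ω \ V n) := hopen.measurableSet.diff (hV n).measurableSet
  have heq : (V n).indicator (fun _ => (1 : ℝ)) - Ω.indicator (fun _ => (1 : ℝ)) =
      -(Ω \ V n).indicator (fun _ => (1 : ℝ)) := by
    rw [indicator_sdiff (hsub n)]
    exact (neg_sub _ _).symm
  simp only [heq, eLpNorm_neg]
  rw [eLpNorm_indicator_const hms one_ne_zero ENNReal.one_ne_top]
  simp only [enorm_one, ENNReal.toReal_one, div_one, ENNReal.rpow_one, one_mul]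
  exact measure_mono fun x hx => ⟨hx.1, hdiff n (Or.inr hx)⟩
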